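/- Let $d\in\mathbb N$, let $V\colon\mathbb R^d\to[0,\infty)$ be a potential with $V(0)=0$, and put $\varphi_V(\alpha)=\sum_{x\in\mathbb Z^d}e^{-\alpha V(x)}\in[0,\infty]$. Assume that there is $\alpha_0\ge 0$ with $\varphi_V(\beta)<\infty$ for all $\beta>\alpha_0$. Environment. Let $\rho\in(0,1/2)$ and let $\theta=\{\theta(x)\}_{x\in\mathbb Z^d}$ be i.i.d. Poisson variables with mean $\rho$, with law $\mathbb P$. Let $\Omega_\theta=\{(x,i): x\in\mathbb Z^d,\ 1\le i\le\theta(x)\}$, $X(x,i)=x$, and let $S_\theta$ be the set of bijections of $\Omega_\theta$, with the topology of pointwise convergence ($\Omega_\theta$ discrete) and its Borel $\sigma$-algebra. Gibbs measures. Let $\alpha>0$. For a finite set $\Lambda\subset\mathbb Z^d$ and $\sigma,\xi\in S_\theta$ let $H_{\theta,\Lambda}(\sigma)=\sum_{s\in\Omega_\theta:\,X(s)\in\Lambda}V\big(X(\sigma(s))-X(s)\big)$, let $S^{\xi}_{\theta,\Lambda}=\{\sigma\in S_\theta:\ \sigma^n(s)=\xi^n(s)\text{ for all }n\in\mathbb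 Z\text{ and all }s\in\Omega_\theta\text{ with }X(s)\notin\Lambda\}$ (a finite set), and let $G^{\xi}_{\theta,\Lambda}$ be the probability measure on $S^{\xi}_{\theta,\Lambda}$ with $G^\xi_{\theta,\Lambda}(\sigma)\propto e^{-\alpha H_{\theta,\Lambda}(\sigma)}$. A probability measure $\mu$ on $S_\theta$ is a Gibbs measure if $\mu(A)=\int G^{\xi}_{\theta,\Lambda}(A)\,d\mu(\xi)$ for all finite $\Lambda\subset\mathbb Z^d$ and all measurable $A\subset S_\theta$. A permutation $\sigma\in S_\theta$ is a finite cycle permutation if every point of $\Omega_\theta$ lies in a finite cycle of $\sigma$. Good densities. Let $L_V=\sup\{\|x\|: x\in\mathbb Z^d,\ V(x)=0\}$ with the Euclidean norm, and for $R\ge0$ let $E(R)$ be the event that there is an infinite sequence $(s_i)_{i\in\mathbb N}$ of distinct points of $\Omega_\theta$ with $\|X(s_i)-X(s_{i+1})\|\le R$ for all $i$. The density $\rho$ is good for $V$ if $L_V<1$ or $\mathbb P(E(L_V))=0$. Constants. Let $C_\rho=\dfrac{\rho\,e^{-\rho+1/2}}{1-2\rho}$ and let $r_0\in[0,1]$ be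 the unique solution in $[0,1]$ of $\dfrac{r}{(1-r)^2}-r=\dfrac12$. Theorem. If $\rho\in(0,1/2)$ is a good density for $V$ and $C_\rho\,\varphi_V(\alpha)<r_0$, then for $\mathbb P$-almost every $\theta$ there is exactly one Gibbs measure $\mu_\theta$ with $\mu_\theta(\{\sigma\in S_\theta:\sigma\text{ is a finite cycle permutation}\})=1$. -/

import Mathlib

open MeasureTheory ProbabilityTheory
open scoped ENNReal NNReal

namespace SpatialPerm

/-- Sites of the lattice `ℤ^d`. -/
abbrev Site (d : ℕ) : Type := Fin d → ℤ

/-- The inclusion of `ℤ^d` in Euclidean space `ℝ^d`. -/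
noncomputable def toReal {d : ℕ} (x : Site d) : EuclideanSpace ℝ (Fin d) :=
  WithLp.toLp 2 (fun i => (x i : ℝ))

/-- The law of an environment `θ`: i.i.d. Poisson(`ρ`) multiplicities at the sites of `ℤ^d`. -/
noncomputable def envLaw (d : ℕ) (ρ : ℝ≥0) : Measure (Site d → ℕ) :=
  Measure.infinitePi (fun _ : Site d => poissonMeasure ρ)

/-- The set of points `Ω_θ`: there are `θ x` tagged points at each site `x`. The projection
`X : Ω_θ → ℤ^d` is `Sigma.fst`. -/
abbrev Points {d : ℕ} (θ : Site d → ℕ) : Type := Σ x : Site d, Fin (θ x)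

/-- The topology of the space `S_θ` of permutations of `Ω_θ`: since every bounded region contains
finitely many points, the distance `2 ^ (-min {‖X s‖ : σ s ≠ σ' s})` induces pointwise convergence,
with `Ω_θ` discrete. -/
instance permTopology {d : ℕ} (θ : Site d → ℕ) : TopologicalSpace (Equiv.Perm (Points θ)) :=
  ⨅ s : Points θ, TopologicalSpace.induced (fun σ : Equiv.Perm (Points θ) => σ s) ⊥

/-- The Borel σ-algebra of `S_θ`. -/
instance permMeasurableSpace {d : ℕ} (θ : Site d → ℕ) :
    MeasurableSpace (Equiv.Perm (Points θ)) :=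
  borel (Equiv.Perm (Points θ))

/-- The Hamiltonian `H_{θ,Λ}(σ) = ∑_{s ∈ Λ} V (X (σ s) - X s)`. -/
noncomputable def hamiltonian {d : ℕ} (V : EuclideanSpace ℝ (Fin d) → ℝ) (θ : Site d → ℕ)
    (Λ : Finset (Site d)) (σ : Equiv.Perm (Points θ)) : ℝ :=
  ∑ x ∈ Λ, ∑ i : Fin (θ x), V (toReal (σ ⟨x, i⟩).1 - toReal x)

/-- The Boltzmann weight `exp (-α H_{θ,Λ}(σ))`. -/
noncomputable def boltzmann {d : ℕ} (V : EuclideanSpace ℝ (Fin d) → ℝ) (α : ℝ) (θ : Site d → ℕ)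
    (Λ : Finset (Site d)) (σ : Equiv.Perm (Points θ)) : ℝ≥0∞ :=
  ENNReal.ofReal (Real.exp (-α * hamiltonian V θ Λ σ))

/-- The permutations compatible with the boundary condition `ξ` at volume `Λ`. -/
def compatible {d : ℕ} (θ : Site d → ℕ) (Λ : Finset (Site d)) (ξ : Equiv.Perm (Points θ)) :
    Set (Equiv.Perm (Points θ)) :=
  {σ | ∀ s : Points θ, s.1 ∉ Λ → ∀ n : ℤ, (σ ^ n) s = (ξ ^ n) s}

/-- The normalizing constant `Z_{θ,Λ}^ξ` (a sum over a finite non-empty set). -/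
noncomputable def partitionFunction {d : ℕ} (V : EuclideanSpace ℝ (Fin d) → ℝ) (α : ℝ)
    (θ : Site d → ℕ) (Λ : Finset (Site d)) (ξ : Equiv.Perm (Points θ)) : ℝ≥0∞ :=
  ∑' σ : compatible θ Λ ξ, boltzmann V α θ Λ σ

/-- The specification `G_{θ,Λ}^ξ`. -/
noncomputable def specification {d : ℕ} (V : EuclideanSpace ℝ (Fin d) → ℝ) (α : ℝ)
    (θ : Site d → ℕ) (Λ : Finset (Site d)) (ξ : Equiv.Perm (Points θ)) :
    Measure (Equiv.Perm (Points θ)) :=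
  Measure.sum (fun σ : compatible θ Λ ξ =>
    (boltzmann V α θ Λ σ / partitionFunction V α θ Λ ξ) •
      Measure.dirac (σ : Equiv.Perm (Points θ)))

/-- `μ` is a Gibbs measure for the potential `V` at temperature `α` in the environment `θ`. -/
def IsGibbs {d : ℕ} (V : EuclideanSpace ℝ (Fin d) → ℝ) (α : ℝ) (θ : Site d → ℕ)
    (μ : Measure (Equiv.Perm (Points θ))) : Prop :=
  IsProbabilityMeasure μ ∧
    ∀ (Λ : Finset (Site d)) (A : Set (Equiv.Perm (Points θ))), MeasurableSet A →
      μ A = ∫⁻ ξ, specification V α θ Λ ξ A ∂μ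

/-- `σ` is a finite cycle permutation: every point lies in a finite cycle of `σ`. -/
def IsFiniteCycle {d : ℕ} {θ : Site d → ℕ} (σ : Equiv.Perm (Points θ)) : Prop :=
  ∀ s : Points θ, ∃ n : ℕ, 0 < n ∧ (σ ^ n) s = s

/-- `φ_V(α) = ∑_{x ∈ ℤ^d} exp (-α V x)`, possibly infinite. -/
noncomputable def phi {d : ℕ} (V : EuclideanSpace ℝ (Fin d) → ℝ) (α : ℝ) : ℝ≥0∞ :=
  ∑' x : Site d, ENNReal.ofReal (Real.exp (-α * V (toReal x)))

/-- `L_V = sup {‖x‖ : V x = 0, x ∈ ℤ^d}`. -/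
noncomputable def zeroRange {d : ℕ} (V : EuclideanSpace ℝ (Fin d) → ℝ) : ℝ :=
  sSup {r : ℝ | ∃ x : Site d, V (toReal x) = 0 ∧ r = ‖toReal x‖}

/-- The event `E(R)`: there is an infinite sequence of (distinct) points of `Ω_θ` with consecutive
points at distance at most `R`. -/
def chainEvent (d : ℕ) (R : ℝ) : Set (Site d → ℕ) :=
  {θ | ∃ s : ℕ → Points θ, Function.Injective s ∧
    ∀ i, ‖toReal (s i).1 - toReal (s (i + 1)).1‖ ≤ R}

/-- `ρ` is a good density for the potential `V`. -/
def IsGoodDensity {d : ℕ} (V : EuclideanSpace ℝ (Fin d) → ℝ) (ρ : ℝ≥0) : Prop :=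
  zeroRange V < 1 ∨ envLaw d ρ (chainEvent d (zeroRange V)) = 0

/-- `C_ρ = ρ e^{-ρ + 1/2} / (1 - 2ρ)`. -/
noncomputable def densityConst (ρ : ℝ) : ℝ :=
  ρ * Real.exp (-ρ + 1 / 2) / (1 - 2 * ρ)

theorem existsUnique_r0 :
    ∃! r : ℝ, r ∈ Set.Icc (0 : ℝ) 1 ∧ r / (1 - r) ^ 2 - r = 1 / 2 := by
  have key : ∀ r : ℝ, r ∈ Set.Icc (0 : ℝ) 1 →
      (r / (1 - r) ^ 2 - r = 1 / 2 ↔ 2 * r ^ 3 - 3 * r ^ 2 - 2 * r + 1 = 0) := by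
    intro r _
    by_cases h1 : r = 1
    · subst h1; norm_num
    · have h2 : (1 - r) ≠ 0 := sub_ne_zero.mpr (Ne.symm h1)
      rw [sub_eq_iff_eq_add, div_eq_iff (pow_ne_zero 2 h2)]
      constructor <;> intro h <;> linarith
  have hc : ContinuousOn (fun r : ℝ => 2 * r ^ 3 - 3 * r ^ 2 - 2 * r + 1) (Set.Icc 0 1) := by
    fun_prop
  obtain ⟨r, hr, hr0⟩ := intermediate_value_Icc' (zero_le_one' ℝ) hc
    (show (0 : ℝ) ∈ Set.Icc _ _ by constructor <;> norm_num)
  refine ⟨r, ⟨hr, (key r hr).mpr hr0⟩, ?_⟩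
  rintro t ⟨ht, ht0⟩
  have ht1 := (key t ht).mp ht0
  simp only at hr0
  obtain ⟨a0, a1⟩ := hr
  obtain ⟨b0, b1⟩ := ht
  have hprod : (t - r) * (2 * (t ^ 2 + t * r + r ^ 2) - 3 * (t + r) - 2) = 0 := by
    linear_combination ht1 - hr0
  rcases mul_eq_zero.mp hprod with h | h
  · linarith
  · nlinarith [mul_nonneg b0 (sub_nonneg.mpr b1), mul_nonneg a0 (sub_nonneg.mpr a1),
      mul_nonneg b0 (sub_nonneg.mpr a1), mul_nonneg a0 (sub_nonneg.mpr b1)]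

/-- The unique solution `r₀ ∈ [0, 1]` of `r / (1 - r)^2 - r = 1 / 2`. -/
noncomputable def r0 : ℝ := Classical.choose existsUnique_r0.exists

end SpatialPerm

/-!
The weights of permutations of a finite set of points are permanents. A four-point inequality for
hafnians bounds the change of `zPart (D \ {s}) / zPart D` when a point `x` is removed from `D` by the
weights of the self-avoiding paths from `s` to `x` and from `x` to `s`. Under the Poisson law these
weights have a finite sum over `x` as soon as `ρ φ < 1`, so the local probabilities converge along
the finite sets of points, whatever the boundary condition. This gives uniqueness, and existence
follows by tightness.
-/

/-! A random permutation of a finite set `D` with weights `∏ K u (σ u)` has the permanent `zPart K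
D` as partition function, and it follows a given permutation `a` of `C ⊆ D` on `C` with probability
the weight of `a` times `zPart K (D \ C) / zPart K D`. The core of the proof is the convergence of
these ratios as `D` grows (`exists_tendsto_avoidProb`). By telescoping it suffices to treat a single
point `s`. Removing `x` from `D` changes the ratio by at most a product of two off-diagonal
permanents over two partition functions; this is the Plücker-type inequality `zPart_plucker`, a case
of `haf_quad`. An off-diagonal permanent describes a path between `s` and `x` together with a
permutation of the remaining points, so by `per_erase_le` the change is at most the total weight of
the self-avoiding paths from `s` to `x` times that of the paths from `x` to `s`.

For almost every environment these products are summable in `x`. The number of ways to lift a list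
of `n` sites to distinct points is bounded by a product of descending factorials with mean exactly
`ρ ^ n`, so each further point costs `ρ` and each jump costs `φ_V(α)`: path weights have finite mean
once `ρ φ_V(α) < 1` (`ae_pathTotal_lt_top`). This follows from the hypothesis, because `ρ ≤ C_ρ` and
`r₀ ≤ 1`.

Uniqueness: under a finite cycle Gibbs measure, a large box contains with high probability an
invariant set around any given finite set. Conditionally, the inner points carry a random
permutation of a large finite set, whatever the boundary condition, so cylinders have the limiting
probabilities (`IsGibbs.measure_cyl`). Existence: with identity boundary condition, a cycle through
`s` is at most as likely as its path weight, which gives tightness. A limit point has the limiting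
cylinder probabilities (`exists_measure_cyl`), and for these the Gibbs equations are an algebraic
identity (`isGibbs_of_measure_cyl`). -/

namespace SpatialPerm

/-! ### Hafnians and their four-point inequalities. -/

section Hafnian

variable {W : Type*} [DecidableEq W]

/-- The hafnian of a symmetric kernel `k` on a finite set `S`: the sum over the perfect matchings
of `S` of the products of the weights of the matched pairs, computed by expanding along a vertex. -/
noncomputable def haf (k : W → W → ℝ≥0) (S : Finset W) : ℝ≥0 :=
  if h : S.Nonempty then
    ∑ u : {u // u ∈ S.erase h.choose}, k h.choose u * haf k ((S.erase h.choose).erase u)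
  else 1
termination_by S.card
decreasing_by
  exact lt_of_le_of_lt (Finset.card_le_card (Finset.erase_subset _ _))
    (Finset.card_erase_lt_of_mem h.choose_spec)

theorem haf_empty (k : W → W → ℝ≥0) : haf k ∅ = 1 := by
  rw [haf]; simp

theorem exists_haf_expand (k : W → W → ℝ≥0) {S : Finset W} (h : S.Nonempty) :
    ∃ y ∈ S, haf k S = ∑ u ∈ S.erase y, k y u * haf k ((S.erase y).erase u) := by
  refine ⟨h.choose, h.choose_spec, ?_⟩
  rw [haf, dif_pos h]
  exact Finset.sum_coe_sort (S.erase h.choose)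
    (fun u => k h.choose u * haf k ((S.erase h.choose).erase u))

/-- The choice of vertex does not matter: expanding a second time, along the other vertex, gives
double sums that agree after exchanging the two partners. -/
theorem haf_expand {k : W → W → ℝ≥0} (hk : ∀ u v, k u v = k v u) (S : Finset W) {y : W}
    (hy : y ∈ S) : haf k S = ∑ u ∈ S.erase y, k y u * haf k ((S.erase y).erase u) := by
  induction hn : S.card using Nat.strong_induction_on generalizing S y with
  | _ n ih =>
    subst hn
    obtain ⟨z, hz, hS⟩ := exists_haf_expand k ⟨y, hy⟩
    rcases eq_or_ne y z with rfl | hyz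
    · exact hS
    rw [hS]
    have expand : ∀ a b : W, a ∈ S → b ∈ S → a ≠ b →
        ∑ u ∈ S.erase a, k a u * haf k ((S.erase a).erase u) =
          k a b * haf k ((S.erase a).erase b) +
          ∑ u ∈ (S.erase a).erase b, ∑ v ∈ ((S.erase a).erase b).erase u,
            k a u * k b v * haf k ((((S.erase a).erase b).erase u).erase v) := by
      intro a b ha hb hab
      rw [← Finset.add_sum_erase (S.erase a) _ (Finset.mem_erase.2 ⟨hab.symm, hb⟩)]
      congr 1
      refine Finset.sum_congr rfl fun u hu => ?_
      have hu' := Finset.mem_erase.1 hu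
      have hb' : b ∈ (S.erase a).erase u :=
        Finset.mem_erase.2 ⟨hu'.1.symm, Finset.mem_erase.2 ⟨hab.symm, hb⟩⟩
      rw [ih _ (lt_of_le_of_lt (Finset.card_le_card (Finset.erase_subset _ _))
        (Finset.card_erase_lt_of_mem ha)) _ hb' rfl, Finset.mul_sum,
        Finset.erase_right_comm (a := u)]
      exact Finset.sum_congr rfl fun v _ => by ring
    rw [expand z y hz hy hyz.symm, expand y z hy hz hyz, hk z y, Finset.erase_right_comm (a := z)]
    congr 1
    rw [Finset.sum_sigma', Finset.sum_sigma']
    refine Finset.sum_nbij' (fun p => ⟨p.2, p.1⟩) (fun p => ⟨p.2, p.1⟩) ?_ ?_ ?_ ?_ ?_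
    · simp only [Finset.mem_sigma, Finset.mem_erase]; tauto
    · simp only [Finset.mem_sigma, Finset.mem_erase]; tauto
    · simp
    · simp
    · rintro ⟨u, v⟩ _
      simp only
      rw [Finset.erase_right_comm (a := u), mul_comm (k z u)]

/-- Each of four numbers is at most the sum of the other three. -/
def Quad (a b c d : ℝ≥0) : Prop :=
  a ≤ b + c + d ∧ b ≤ a + c + d ∧ c ≤ a + b + d ∧ d ≤ a + b + c

theorem Quad.add {a b c d a' b' c' d' : ℝ≥0} (h : Quad a b c d) (h' : Quad a' b' c' d') :
    Quad (a + a') (b + b') (c + c') (d + d') := by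
  simp only [Quad, ← NNReal.coe_le_coe, NNReal.coe_add] at *
  refine ⟨?_, ?_, ?_, ?_⟩ <;> linarith [h.1, h.2.1, h.2.2.1, h.2.2.2]

theorem Quad.sum {I : Type*} {T : Finset I} {a b c d : I → ℝ≥0} (k : I → ℝ≥0)
    (h : ∀ u ∈ T, Quad (a u) (b u) (c u) (d u)) :
    Quad (∑ u ∈ T, k u * a u) (∑ u ∈ T, k u * b u) (∑ u ∈ T, k u * c u)
      (∑ u ∈ T, k u * d u) := by
  simp only [Quad, ← Finset.sum_add_distrib, ← mul_add]
  refine ⟨?_, ?_, ?_, ?_⟩ <;> refine Finset.sum_le_sum fun u hu => ?_ <;> gcongr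
  · exact (h u hu).1
  · exact (h u hu).2.1
  · exact (h u hu).2.2.1
  · exact (h u hu).2.2.2

/-- Expansion of the product of two hafnians along a vertex `p` of the second factor, sorted by
whether the partner of `p` belongs to the common part `T` of the two index sets. -/
theorem haf_mul_expand {k : W → W → ℝ≥0} (hk : ∀ u v, k u v = k v u) {T B : Finset W} {p : W}
    (hp : p ∉ T) (hpB : p ∉ B) (hTB : Disjoint T B) (x : ℝ≥0) :
    x * haf k (insert p (T ∪ B)) =
      ∑ u ∈ B, k p u * (x * haf k (T ∪ B.erase u)) +
      ∑ u ∈ T, k p u * (x * haf k (T.erase u ∪ B)) := by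
  have hp' : p ∉ T ∪ B := by simp [hp, hpB]
  rw [haf_expand hk _ (Finset.mem_insert_self p _), Finset.erase_insert hp',
    Finset.sum_union hTB, mul_add, Finset.mul_sum, Finset.mul_sum, add_comm]
  congr 1
  · refine Finset.sum_congr rfl fun u hu => ?_
    rw [Finset.erase_union_distrib, Finset.erase_eq_of_notMem (Finset.disjoint_right.1 hTB hu)]
    ring
  · refine Finset.sum_congr rfl fun u hu => ?_
    rw [Finset.erase_union_distrib, Finset.erase_eq_of_notMem (Finset.disjoint_left.1 hTB hu)]
    ring

/-- The four-point inequalities for hafnians: the vertices `p, q, r, s` are distributed in two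
colours over two copies of `T`, and in each parity class every colouring has at most the total mass
of the other three. -/
theorem haf_quad {k : W → W → ℝ≥0} (hk : ∀ u v, k u v = k v u) (T : Finset W) {p q r s : W}
    (hp : p ∉ T) (hq : q ∉ T) (hr : r ∉ T) (hs : s ∉ T) (hpq : p ≠ q) (hpr : p ≠ r) (hps : p ≠ s)
    (hqr : q ≠ r) (hqs : q ≠ s) (hrs : r ≠ s) :
    Quad (haf k T * haf k (insert p (T ∪ {q, r, s})))
        (haf k (T ∪ {r, s}) * haf k (insert p (T ∪ {q})))
        (haf k (T ∪ {q, s}) * haf k (insert p (T ∪ {r})))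
        (haf k (T ∪ {q, r}) * haf k (insert p (T ∪ {s}))) ∧
      Quad (haf k (T ∪ {q, r, s}) * haf k (insert p (T ∪ ∅)))
        (haf k (T ∪ {q}) * haf k (insert p (T ∪ {r, s})))
        (haf k (T ∪ {r}) * haf k (insert p (T ∪ {q, s})))
        (haf k (T ∪ {s}) * haf k (insert p (T ∪ {q, r}))) := by
  induction hn : T.card using Nat.strong_induction_on generalizing T p with
  | _ n ih =>
    subst hn
    -- If `p` is matched with `u ∈ T`, then `u` survives only in the other factor and takes over the
    -- role of `p` over `T.erase u`. The colours are exchanged, so each parity class is reduced to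
    -- the other; hence the joint induction.
    have step : ∀ u ∈ T, _ := fun u hu =>
      ih (T.erase u).card (Finset.card_erase_lt_of_mem hu) (T.erase u) (p := u) (by simp)
        (by simp [hq]) (by simp [hr]) (by simp [hs]) (fun h => hq (h ▸ hu)) (fun h => hr (h ▸ hu))
        (fun h => hs (h ▸ hu)) rfl
    have hins : ∀ u ∈ T, ∀ B : Finset W, insert u (T.erase u ∪ B) = T ∪ B := fun u hu B => by
      rw [← Finset.insert_union, Finset.insert_erase hu]
    have e1 : ({q, r, s} : Finset W).erase q = {r, s} := by
      rw [Finset.erase_insert]; simp [hqr, hqs]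
    have e2 : ({q, r, s} : Finset W).erase r = {q, s} := by
      ext a; simp only [Finset.mem_erase, Finset.mem_insert, Finset.mem_singleton]; grind
    have e3 : ({q, r, s} : Finset W).erase s = {q, r} := by
      ext a; simp only [Finset.mem_erase, Finset.mem_insert, Finset.mem_singleton]; grind
    have f1 : ∀ a b : W, a ≠ b → ({a, b} : Finset W).erase a = {b} := fun a b h => by
      rw [Finset.erase_insert]; simpa using h
    have f2 : ∀ a b : W, a ≠ b → ({a, b} : Finset W).erase b = {a} := fun a b h => by
      rw [Finset.pair_comm, f1 _ _ h.symm]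
    have g1 : ∀ a : W, ({a} : Finset W).erase a = ∅ := fun a => by simp
    have hd : ∀ B : Finset W, B ⊆ {q, r, s} → Disjoint T B := fun B hB =>
      Finset.disjoint_of_subset_right hB (by simp [hq, hr, hs])
    have hnp : ∀ B : Finset W, B ⊆ {q, r, s} → p ∉ B := fun B hB h => by
      have := hB h; simp [hpq, hpr, hps] at this
    have expand : ∀ (B : Finset W) (x : ℝ≥0), B ⊆ {q, r, s} → _ := fun B x hB =>
      haf_mul_expand hk hp (hnp B hB) (hd B hB) x
    have s0 : ({q, r, s} : Finset W) ⊆ {q, r, s} := subset_rfl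
    have s1 : ({q} : Finset W) ⊆ {q, r, s} := by simp
    have s2 : ({r} : Finset W) ⊆ {q, r, s} := by simp
    have s3 : ({s} : Finset W) ⊆ {q, r, s} := by simp
    have s4 : ({r, s} : Finset W) ⊆ {q, r, s} := by simp
    have s5 : ({q, s} : Finset W) ⊆ {q, r, s} := by rw [← e2]; exact Finset.erase_subset _ _
    have s6 : ({q, r} : Finset W) ⊆ {q, r, s} := by rw [← e3]; exact Finset.erase_subset _ _
    have s7 : (∅ : Finset W) ⊆ {q, r, s} := by simp
    constructor
    · rw [expand _ _ s0, expand _ _ s1, expand _ _ s2, expand _ _ s3]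
      refine Quad.add ?_ (Quad.sum _ fun u hu => ?_)
      -- When `p` is matched with one of `q, r, s`, the first mass is exactly the sum of the other
      -- three.
      · rw [Finset.sum_insert (by simp [hqr, hqs]), Finset.sum_pair hrs]
        simp only [Finset.sum_singleton, e1, e2, e3, g1, Finset.union_empty]
        simp only [Quad, mul_comm (haf k T)]
        refine ⟨le_of_eq (by ring), ?_, ?_, ?_⟩
        · exact le_add_right (le_add_right le_self_add)
        · exact le_add_right (le_add_right (le_add_left le_self_add))
        · exact le_add_right (le_add_right (le_add_left le_add_self))
      · have := (step u hu).2
        simp only [hins u hu] at this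
        simpa only [mul_comm, Finset.union_empty] using this
    · rw [expand _ _ s7, expand _ _ s4, expand _ _ s5, expand _ _ s6]
      refine Quad.add ?_ (Quad.sum _ fun u hu => ?_)
      -- Here the first mass vanishes, and each of the three products below occurs in exactly two of
      -- the other masses.
      · rw [Finset.sum_pair hrs, Finset.sum_pair hqs, Finset.sum_pair hqr, Finset.sum_empty,
          f1 _ _ hrs, f2 _ _ hrs, f1 _ _ hqs, f2 _ _ hqs, f1 _ _ hqr, f2 _ _ hqr]
        simp only [Quad, ← NNReal.coe_le_coe, NNReal.coe_add, NNReal.coe_mul, NNReal.coe_zero]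
        refine ⟨by positivity, ?_, ?_, ?_⟩
        all_goals
          have h1 : (0 : ℝ) ≤ k p q * (haf k (T ∪ {r}) * haf k (T ∪ {s})) := by positivity
          have h2 : (0 : ℝ) ≤ k p r * (haf k (T ∪ {q}) * haf k (T ∪ {s})) := by positivity
          have h3 : (0 : ℝ) ≤ k p s * (haf k (T ∪ {q}) * haf k (T ∪ {r})) := by positivity
          nlinarith
      · have := (step u hu).1
        simp only [hins u hu] at this
        simpa only [mul_comm, Finset.union_empty] using this

end Hafnian

/-! ### Permanents as bipartite hafnians, and partition functions. -/

section Permanent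

variable {ι : Type*} [DecidableEq ι]

/-- The symmetric kernel on rows and columns given by a matrix `K`. -/
def biKernel (K : ι → ι → ℝ≥0) : ι ⊕ ι → ι ⊕ ι → ℝ≥0
  | Sum.inl r, Sum.inr c => K r c
  | Sum.inr c, Sum.inl r => K r c
  | _, _ => 0

theorem biKernel_symm {ι : Type*} (K : ι → ι → ℝ≥0) (u v : ι ⊕ ι) :
    biKernel K u v = biKernel K v u := by
  rcases u with u | u <;> rcases v with v | v <;> rfl

/-- The permanent of the submatrix of `K` with rows `R` and columns `C`. -/
noncomputable def per (K : ι → ι → ℝ≥0) (R C : Finset ι) : ℝ≥0 :=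
  haf (biKernel K) (R.disjSum C)

theorem per_row (K : ι → ι → ℝ≥0) {R : Finset ι} (C : Finset ι) {r : ι} (hr : r ∈ R) :
    per K R C = ∑ c ∈ C, K r c * per K (R.erase r) (C.erase c) := by
  have h1 : (R.disjSum C).erase (Sum.inl r) = (R.erase r).disjSum C := by
    ext (a | a) <;> simp
  have h2 : ∀ c, ((R.erase r).disjSum C).erase (Sum.inr c) = (R.erase r).disjSum (C.erase c) :=
    fun c => by ext (a | a) <;> simp
  rw [per, haf_expand (biKernel_symm K) _ (Finset.inl_mem_disjSum.2 hr), h1, Finset.sum_disjSum]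
  simp [biKernel, h2, per]

theorem per_col (K : ι → ι → ℝ≥0) (R : Finset ι) {C : Finset ι} {c : ι} (hc : c ∈ C) :
    per K R C = ∑ r ∈ R, K r c * per K (R.erase r) (C.erase c) := by
  have h1 : (R.disjSum C).erase (Sum.inr c) = R.disjSum (C.erase c) := by
    ext (a | a) <;> simp
  have h2 : ∀ r, (R.disjSum (C.erase c)).erase (Sum.inl r) = (R.erase r).disjSum (C.erase c) :=
    fun c => by ext (a | a) <;> simp
  rw [per, haf_expand (biKernel_symm K) _ (Finset.inr_mem_disjSum.2 hc), h1, Finset.sum_disjSum]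
  simp [biKernel, h2, per]

theorem per_empty (K : ι → ι → ℝ≥0) : per K ∅ ∅ = 1 := by
  simp [per, haf_empty]

theorem per_of_card_ne (K : ι → ι → ℝ≥0) (R : Finset ι) :
    ∀ C : Finset ι, R.card ≠ C.card → per K R C = 0 := by
  induction R using Finset.induction_on with
  | empty =>
    intro C hC
    obtain ⟨c, hc⟩ : C.Nonempty := by
      rw [Finset.nonempty_iff_ne_empty]; rintro rfl; simp at hC
    rw [per_col K _ hc, Finset.sum_empty]
  | insert r R hr ih =>
    intro C hC
    rw [per_row K C (Finset.mem_insert_self r R), Finset.erase_insert hr]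
    refine Finset.sum_eq_zero fun c hc => ?_
    rw [ih, mul_zero]
    rw [Finset.card_insert_of_notMem hr] at hC
    have := Finset.card_erase_add_one hc
    omega

theorem per_transpose (K : ι → ι → ℝ≥0) (R : Finset ι) :
    ∀ C : Finset ι, per (fun a b => K b a) C R = per K R C := by
  induction R using Finset.induction_on with
  | empty =>
    intro C
    rcases C.eq_empty_or_nonempty with rfl | ⟨c, hc⟩
    · rw [per_empty, per_empty]
    · rw [per_row _ _ hc, per_col _ _ hc]; simp
  | insert r R hr ih =>
    intro C
    rw [per_row K C (Finset.mem_insert_self r R), per_col _ C (Finset.mem_insert_self r R),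
      Finset.erase_insert hr]
    simp_rw [ih]

/-- A permanent of the form `per K D (g '' D)` is a sum over the permutations of `D`. -/
theorem sum_perms_eq_per (K : ι → ι → ℝ≥0) (D : Finset ι) :
    ∀ g : ι → ι, Set.InjOn g D →
      ∑ σ ∈ permsOfFinset D, ∏ u ∈ D, K u (g (σ u)) = per K D (D.image g) := by
  induction D using Finset.induction_on with
  | empty =>
    intro g _
    have : permsOfFinset (∅ : Finset ι) = {1} := by
      ext σ
      simp only [mem_perms_of_finset_iff, Finset.notMem_empty, imp_false, not_not,
        Finset.mem_singleton]
      exact ⟨fun h => Equiv.ext fun x => h, fun h => by simp [h]⟩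
    simp [this, per_empty]
  | insert s D hs ih =>
    intro g hg
    rw [per_row K _ (Finset.mem_insert_self s D), Finset.erase_insert hs,
      Finset.sum_image hg]
    -- A permutation sending `s` to `t` is `swap s t * σ` for a unique `σ` fixing `s`. The swap is
    -- absorbed in the column map, which is why the induction is over all `g`.
    have key : ∀ t ∈ insert s D, K s (g t) * per K D (((insert s D).image g).erase (g t)) =
        ∑ σ ∈ permsOfFinset D,
          ∏ u ∈ insert s D, K u (g ((Equiv.swap s t * σ) u)) := by
      intro t ht
      have hmap : ∀ u ∈ D, Equiv.swap s t u ∈ insert s D ∧ Equiv.swap s t u ≠ t := by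
        intro u hu
        have hus : u ≠ s := fun h => hs (h ▸ hu)
        rcases eq_or_ne u t with rfl | hut
        · rw [Equiv.swap_apply_right]; exact ⟨Finset.mem_insert_self _ _, hus.symm⟩
        · rw [Equiv.swap_apply_of_ne_of_ne hus hut]; exact ⟨Finset.mem_insert_of_mem hu, hut⟩
      have hinj : Set.InjOn (g ∘ Equiv.swap s t) D := by
        intro a ha b hb hab
        exact (Equiv.swap s t).injective (hg (hmap a ha).1 (hmap b hb).1 hab)
      have himg : D.image (g ∘ Equiv.swap s t) = ((insert s D).image g).erase (g t) := by
        refine Finset.eq_of_subset_of_card_le ?_ ?_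
        · intro y hy
          obtain ⟨u, hu, rfl⟩ := Finset.mem_image.1 hy
          refine Finset.mem_erase.2 ⟨fun h => (hmap u hu).2 (hg (hmap u hu).1 ht h),
            Finset.mem_image_of_mem _ (hmap u hu).1⟩
        · rw [Finset.card_erase_of_mem (Finset.mem_image_of_mem _ ht),
            Finset.card_image_of_injOn hg, Finset.card_image_of_injOn hinj,
            Finset.card_insert_of_notMem hs]
          omega
      rw [← himg, ← ih _ hinj, Finset.mul_sum]
      refine Finset.sum_congr rfl fun σ hσ => ?_
      rw [Finset.prod_insert hs]
      have hσs : σ s = s := by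
        by_contra h; exact hs (mem_perms_of_finset_iff.1 hσ h)
      simp [hσs]
    rw [Finset.sum_congr rfl key, Finset.sum_sigma']
    symm
    refine Finset.sum_bij' (fun p _ => Equiv.swap s p.1 * p.2)
      (fun σ _ => ⟨σ s, Equiv.swap s (σ s) * σ⟩) ?_ ?_ ?_ ?_ ?_
    · rintro ⟨t, σ⟩ h
      simp only [Finset.mem_sigma] at h
      refine mem_perms_of_finset_iff.2 fun {x} hx => ?_
      by_contra hxD
      rw [Finset.mem_insert, not_or] at hxD
      have hσx : σ x = x := by
        by_contra h'; exact hxD.2 (mem_perms_of_finset_iff.1 h.2 h')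
      apply hx
      simp only [Equiv.Perm.mul_apply, hσx]
      refine Equiv.swap_apply_of_ne_of_ne hxD.1 ?_
      rintro rfl
      exact (Finset.mem_insert.1 h.1).elim hxD.1 hxD.2
    · intro σ hσ
      refine Finset.mem_sigma.2 ⟨?_, mem_perms_of_finset_iff.2 fun {x} hx => ?_⟩
      · simp only
        by_contra h
        have h2 : σ (σ s) = σ s := by
          by_contra h'; exact h (mem_perms_of_finset_iff.1 hσ h')
        rw [σ.injective h2] at h
        exact h (Finset.mem_insert_self _ _)
      · simp only [Equiv.Perm.mul_apply] at hx
        have hxs : x ≠ s := by rintro rfl; simp at hx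
        by_contra hxD
        have hσx : σ x = x := by
          by_contra h'
          exact (Finset.mem_insert.1 (mem_perms_of_finset_iff.1 hσ h')).elim hxs hxD
        rw [hσx] at hx
        refine hx (Equiv.swap_apply_of_ne_of_ne hxs fun h => hxs ?_)
        exact σ.injective (hσx.trans h)
    · rintro ⟨t, σ⟩ h
      have hσs : σ s = s := by
        by_contra h'; exact hs (mem_perms_of_finset_iff.1 (Finset.mem_sigma.1 h).2 h')
      simp [hσs, ← mul_assoc]
    · intro σ hσ
      simp [← mul_assoc]
    · intro p hp
      rfl

/-- The partition function of the permutations of `D`. -/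
noncomputable def zPart (K : ι → ι → ℝ≥0) (D : Finset ι) : ℝ≥0 := per K D D

/-- Fixed points have weight one, so extending permutations by fixed points preserves their weights.
-/
theorem zPart_mono {K : ι → ι → ℝ≥0} (hK : ∀ u, K u u = 1) {D E : Finset ι} (h : D ⊆ E) :
    zPart K D ≤ zPart K E := by
  have step : ∀ F : Finset ι, zPart K D ≤ zPart K (F ∪ D) := by
    intro F
    induction F using Finset.induction_on with
    | empty => simp
    | insert s F hs ih =>
      refine ih.trans ?_
      rw [Finset.insert_union]
      by_cases hsD : s ∈ F ∪ D
      · rw [Finset.insert_eq_of_mem hsD]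
      · simp only [zPart]
        rw [per_row K _ (Finset.mem_insert_self s _)]
        refine le_trans (le_of_eq ?_) (Finset.single_le_sum (fun _ _ => zero_le)
          (Finset.mem_insert_self s (F ∪ D)))
        rw [hK, one_mul, Finset.erase_insert hsD]
  have := step E
  rwa [Finset.union_eq_left.2 h] at this

theorem one_le_zPart {K : ι → ι → ℝ≥0} (hK : ∀ u, K u u = 1) (D : Finset ι) :
    1 ≤ zPart K D := by
  have := zPart_mono hK (Finset.empty_subset D)
  rwa [zPart, per_empty] at this

/-- The Plücker-type triangle inequalities for partition functions. -/
theorem zPart_plucker (K : ι → ι → ℝ≥0) {D : Finset ι} {s x : ι} (hs : s ∈ D) (hx : x ∈ D)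
    (hsx : s ≠ x) :
    zPart K D * zPart K ((D.erase s).erase x) ≤ zPart K (D.erase s) * zPart K (D.erase x) +
        per K (D.erase x) (D.erase s) * per K (D.erase s) (D.erase x) ∧
      zPart K (D.erase s) * zPart K (D.erase x) ≤ zPart K D * zPart K ((D.erase s).erase x) +
        per K (D.erase x) (D.erase s) * per K (D.erase s) (D.erase x) := by
  set F := (D.erase s).erase x with hF
  have hsF : s ∉ F := by simp [hF]
  have hxF : x ∉ F := by simp [hF]
  -- The four vertices are the rows and the columns of `s` and `x`.
  have hquad := (haf_quad (biKernel_symm K) (F.disjSum F) (p := Sum.inl s) (q := Sum.inl x)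
    (r := Sum.inr s) (s := Sum.inr x) (by simp [hsF]) (by simp [hxF]) (by simp [hsF])
    (by simp [hxF]) (by simp [hsx]) (by simp) (by simp) (by simp) (by simp) (by simp [hsx])).1
  have h0 : insert (Sum.inl s) (F.disjSum F ∪ {Sum.inl x, Sum.inr s, Sum.inr x}) =
      D.disjSum D := by
    ext (a | a) <;> simp [hF] <;> grind
  have h1 : F.disjSum F ∪ {Sum.inr s, Sum.inr x} = F.disjSum D := by
    ext (a | a)
    · simp [hF]
    · simp [hF]; grind
  have h2 : F.disjSum F ∪ {Sum.inl x, Sum.inr x} = (D.erase s).disjSum (D.erase s) := by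
    ext (a | a) <;> simp [hF] <;> grind
  have h3 : insert (Sum.inl s) (F.disjSum F ∪ {Sum.inr s}) =
      (D.erase x).disjSum (D.erase x) := by
    ext (a | a) <;> simp [hF] <;> grind
  have h4 : F.disjSum F ∪ {Sum.inl x, Sum.inr s} = (D.erase s).disjSum (D.erase x) := by
    ext (a | a) <;> simp [hF] <;> grind
  have h5 : insert (Sum.inl s) (F.disjSum F ∪ {Sum.inr x}) =
      (D.erase x).disjSum (D.erase s) := by
    ext (a | a) <;> simp [hF] <;> grind
  rw [h0, h1, h2, h3, h4, h5] at hquad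
  -- The colouring that puts both rows on one side and both columns on the other has no perfect
  -- matching; only three masses remain.
  have hcard : per K F D = 0 := by
    refine per_of_card_ne K F D (ne_of_lt (Finset.card_lt_card ?_))
    exact ⟨(Finset.erase_subset _ _).trans (Finset.erase_subset _ _), fun h => hsF (h hs)⟩
  obtain ⟨q1, -, q2, -⟩ := hquad
  simp only [← per.eq_1 K, hcard, zero_mul, zero_add, add_zero] at q1 q2
  simp only [zPart]
  refine ⟨?_, ?_⟩
  · rw [mul_comm, mul_comm (per K (D.erase x) (D.erase s))]; exact q1
  · rw [mul_comm (per K D D), mul_comm (per K (D.erase x) (D.erase s))]; exact q2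

end Permanent

/-! ### Self-avoiding paths, influences, and convergence along finite sets. -/

section Influence

variable {ι : Type*}

/-- The weight of a path. -/
def pathWeight (K : ι → ι → ℝ≥0) : List ι → ℝ≥0
  | [] => 1
  | [_] => 1
  | a :: b :: l => K a b * pathWeight K (b :: l)

/-- The total weight of the self-avoiding paths from `s`. -/
noncomputable def pathTotal (K : ι → ι → ℝ≥0) (s : ι) : ℝ≥0∞ :=
  ∑' l : List ι, {l | (s :: l).Nodup}.indicator (fun l => (pathWeight K (s :: l) : ℝ≥0∞)) l

/-- The total weight of the self-avoiding paths from `s` to `x`, up to the initial point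
contained in `D`. -/
noncomputable def greenIn (K : ι → ι → ℝ≥0) (D : Set ι) (s x : ι) : ℝ≥0∞ :=
  ∑' l : List ι, {l | (s :: l).Nodup ∧ (∀ a ∈ l, a ∈ D) ∧ (s :: l).getLast? = some x}.indicator
    (fun l => (pathWeight K (s :: l) : ℝ≥0∞)) l

/-- The total weight of the self-avoiding paths from `s` to `x`. -/
noncomputable def green (K : ι → ι → ℝ≥0) (s x : ι) : ℝ≥0∞ := greenIn K Set.univ s x

theorem greenIn_mono (K : ι → ι → ℝ≥0) {D E : Set ι} (h : D ⊆ E) (s x : ι) :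
    greenIn K D s x ≤ greenIn K E s x :=
  ENNReal.tsum_le_tsum fun l => Set.indicator_le_indicator_of_subset
    (by rintro l ⟨h1, h2, h3⟩; exact ⟨h1, fun a ha => h (h2 a ha), h3⟩) (fun _ => zero_le) l

theorem one_le_greenIn (K : ι → ι → ℝ≥0) (D : Set ι) (x : ι) : 1 ≤ greenIn K D x x := by
  refine le_trans ?_ (ENNReal.le_tsum [])
  simp [pathWeight]

theorem tsum_list_eq (f : List ι → ℝ≥0∞) :
    ∑' l, f l = f [] + ∑' c, ∑' l, f (c :: l) := by
  let e : Unit ⊕ (ι × List ι) ≃ List ι :=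
    { toFun := Sum.elim (fun _ => []) fun p => p.1 :: p.2
      invFun := fun l => match l with
        | [] => Sum.inl ()
        | c :: l => Sum.inr (c, l)
      left_inv := by rintro (_ | ⟨c, l⟩) <;> rfl
      right_inv := by rintro (_ | ⟨c, l⟩) <;> rfl }
  rw [← e.tsum_eq, Summable.tsum_sum ENNReal.summable ENNReal.summable, tsum_fintype,
    ENNReal.tsum_prod']
  simp [e]

theorem tsum_green_le (K : ι → ι → ℝ≥0) (s : ι) : ∑' x, green K s x ≤ pathTotal K s := by
  classical
  unfold green greenIn pathTotal
  rw [ENNReal.tsum_comm]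
  refine ENNReal.tsum_le_tsum fun l => ?_
  by_cases hl : (s :: l).Nodup
  · rw [tsum_eq_single ((s :: l).getLast (by simp))]
    · exact Set.indicator_le_indicator_of_subset (fun _ hl => hl.1) (fun _ => zero_le) l
    · intro x hx
      refine Set.indicator_of_notMem ?_ _
      rintro ⟨-, -, h⟩
      rw [List.getLast?_eq_getLast_of_ne_nil (by simp)] at h
      exact hx (Option.some_injective _ h).symm
  · rw [ENNReal.tsum_eq_zero.2 fun x => Set.indicator_of_notMem (fun h => hl h.1) _]
    exact zero_le

variable [DecidableEq ι]

/-- Decomposition at the first step: prepending `s` to a self-avoiding path that stays in `D.erase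
s` keeps it self-avoiding. -/
theorem sum_mul_greenIn_le (K : ι → ι → ℝ≥0) (D : Finset ι) (s x : ι) :
    ∑ c ∈ D.erase s, (K s c : ℝ≥0∞) * greenIn K (D.erase s) c x ≤ greenIn K D s x := by
  conv_rhs => rw [greenIn, tsum_list_eq]
  refine le_trans ?_ le_add_self
  refine le_trans ?_ (ENNReal.sum_le_tsum (D.erase s))
  refine Finset.sum_le_sum fun c hc => ?_
  rw [greenIn, ← ENNReal.tsum_mul_left]
  refine ENNReal.tsum_le_tsum fun l => ?_
  by_cases h : l ∈ {l | (c :: l).Nodup ∧ (∀ a ∈ l, a ∈ ((D.erase s : Finset ι) : Set ι)) ∧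
      (c :: l).getLast? = some x}
  · rw [Set.indicator_of_mem h, Set.indicator_of_mem]
    · simp [pathWeight]
    · obtain ⟨h1, h2, h3⟩ := h
      simp only [Finset.mem_erase, Finset.mem_coe] at hc h2
      refine ⟨?_, ?_, ?_⟩
      · rw [List.nodup_cons]
        refine ⟨?_, h1⟩
        rw [List.mem_cons, not_or]
        exact ⟨hc.1.symm, fun hl => (h2 s hl).1 rfl⟩
      · intro a ha
        rcases List.mem_cons.1 ha with rfl | ha
        · exact hc.2
        · exact (h2 a ha).2
      · rw [List.getLast?_cons_cons]; exact h3
  · rw [Set.indicator_of_notMem h, mul_zero]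
    exact zero_le

/-- A bijection from `D.erase x` to `D.erase s` is a path from `s` to `x` together with a
permutation of the points off the path. Expanding along row `s` follows the first step `c` and
leaves the same problem on `D.erase s` started from `c`; the leftover permutations are bounded by
monotonicity of `zPart`. -/
theorem per_erase_le {K : ι → ι → ℝ≥0} (hK : ∀ u, K u u = 1) (D : Finset ι) {s x : ι}
    (hs : s ∈ D) (hx : x ∈ D) :
    (per K (D.erase x) (D.erase s) : ℝ≥0∞) ≤ green K s x * zPart K (D.erase x) := by
  suffices h : (per K (D.erase x) (D.erase s) : ℝ≥0∞) ≤
      greenIn K D s x * zPart K (D.erase x) from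
    h.trans (mul_le_mul_left (greenIn_mono K (Set.subset_univ _) s x) _)
  induction hn : D.card generalizing D s with
  | zero => simp [Finset.card_eq_zero.1 hn] at hs
  | succ n ih =>
    rcases eq_or_ne s x with rfl | hsx
    · calc (per K (D.erase s) (D.erase s) : ℝ≥0∞) = 1 * zPart K (D.erase s) := by
            rw [one_mul, zPart]
        _ ≤ _ := mul_le_mul_left (one_le_greenIn K D s) _
    rw [per_row K _ (Finset.mem_erase.2 ⟨hsx, hs⟩), ENNReal.ofNNReal_finsetSum]
    refine le_trans ?_ (mul_le_mul_left (sum_mul_greenIn_le K D s x) _)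
    rw [Finset.sum_mul]
    refine Finset.sum_le_sum fun c hc => ?_
    rw [ENNReal.coe_mul, mul_assoc, Finset.erase_right_comm]
    gcongr
    refine (ih (D.erase s) hc (Finset.mem_erase.2 ⟨hsx.symm, hx⟩) ?_).trans ?_
    · rw [Finset.card_erase_of_mem hs]; omega
    · gcongr
      exact zPart_mono hK (Finset.erase_subset_erase _ (Finset.erase_subset _ _))

/-- The influence of a point `x` on the event that `s` is a fixed point. -/
noncomputable def influence (K : ι → ι → ℝ≥0) (s x : ι) : ℝ≥0∞ :=
  green K s x * green (fun a b => K b a) s x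

theorem tsum_influence_lt_top {ι : Type*} {K : ι → ι → ℝ≥0} (s : ι) (h : pathTotal K s < ∞)
    (h' : pathTotal (fun a b => K b a) s < ∞) : ∑' x, influence K s x < ∞ := by
  refine lt_of_le_of_lt ?_ (ENNReal.mul_lt_top h h')
  calc ∑' x, influence K s x
      ≤ ∑' x, pathTotal K s * green (fun a b => K b a) s x :=
        ENNReal.tsum_le_tsum fun x => mul_le_mul_left
          ((ENNReal.le_tsum x).trans (tsum_green_le K s)) _
    _ = pathTotal K s * ∑' x, green (fun a b => K b a) s x := ENNReal.tsum_mul_left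
    _ ≤ _ := mul_le_mul_right (tsum_green_le _ s) _

/-- The probability that `s` is a fixed point of a random permutation of `D`. -/
noncomputable def fixProb (K : ι → ι → ℝ≥0) (D : Finset ι) (s : ι) : ℝ :=
  zPart K (D.erase s) / zPart K D

/-- Over the common denominator, the difference has as numerator exactly the expression controlled
on both sides by `zPart_plucker`. -/
theorem abs_fixProb_erase_sub_le {K : ι → ι → ℝ≥0} (hK : ∀ u, K u u = 1) {D : Finset ι}
    {s x : ι} (hs : s ∈ D) (hx : x ∈ D) (hsx : s ≠ x) (hfin : influence K s x ≠ ∞) :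
    |fixProb K (D.erase x) s - fixProb K D s| ≤ (influence K s x).toReal := by
  obtain ⟨p1, p2⟩ := zPart_plucker K hs hx hsx
  have hp : per K (D.erase x) (D.erase s) * per K (D.erase s) (D.erase x) ≤
      (influence K s x).toNNReal * (zPart K (D.erase x) * zPart K D) := by
    rw [← ENNReal.coe_le_coe, ENNReal.coe_mul, ENNReal.coe_mul, ENNReal.coe_toNNReal hfin,
      ENNReal.coe_mul, influence]
    have h1 := per_erase_le hK D hs hx
    -- Transposition turns this into the previous bound for the reversed kernel. Enlarging `D.erase
    -- x` to `D` makes the two partition functions match the common denominator.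
    have h2 : (per K (D.erase s) (D.erase x) : ℝ≥0∞) ≤
        green (fun a b => K b a) s x * zPart K D := by
      have := per_erase_le (K := fun a b => K b a) hK D hs hx
      rw [zPart, per_transpose K, per_transpose K] at this
      refine this.trans ?_
      gcongr
      exact zPart_mono hK (Finset.erase_subset _ _)
    calc _ ≤ _ := mul_le_mul' h1 h2
      _ = _ := by ring
  have z1 : (1 : ℝ) ≤ zPart K D := by exact_mod_cast one_le_zPart hK D
  have z2 : (1 : ℝ) ≤ zPart K (D.erase x) := by exact_mod_cast one_le_zPart hK _
  have hfix : fixProb K (D.erase x) s - fixProb K D s =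
      (zPart K D * zPart K ((D.erase s).erase x) - zPart K (D.erase s) * zPart K (D.erase x)) /
        (zPart K (D.erase x) * zPart K D) := by
    rw [fixProb, fixProb, Finset.erase_right_comm]
    field_simp
  have hpos : (0 : ℝ) < zPart K (D.erase x) * zPart K D := by positivity
  rw [hfix, abs_div, abs_of_pos hpos, div_le_iff₀ hpos, abs_le]
  rw [← NNReal.coe_le_coe] at p1 p2 hp
  simp only [NNReal.coe_add, NNReal.coe_mul] at p1 p2 hp
  change _ ≤ (influence K s x).toReal * _ at hp
  constructor <;> linarith

theorem abs_fixProb_sdiff_sub_le {K : ι → ι → ℝ≥0} (hK : ∀ u, K u u = 1) {D : Finset ι} {s : ι}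
    (hs : s ∈ D) (hfin : ∀ x, influence K s x ≠ ∞) (J : Finset ι) (hJ : J ⊆ D) (hsJ : s ∉ J) :
    |fixProb K (D \ J) s - fixProb K D s| ≤ ∑ x ∈ J, (influence K s x).toReal := by
  induction J using Finset.induction_on with
  | empty => simp
  | insert x J hx ih =>
    rw [Finset.mem_insert, not_or] at hsJ
    have h1 := ih ((Finset.subset_insert _ _).trans hJ) hsJ.2
    have h2 := abs_fixProb_erase_sub_le hK (D := D \ J) (Finset.mem_sdiff.2 ⟨hs, hsJ.2⟩)
      (Finset.mem_sdiff.2 ⟨hJ (Finset.mem_insert_self _ _), hx⟩) hsJ.1 (hfin x)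
    rw [Finset.sum_insert hx, Finset.sdiff_insert]
    refine (abs_sub_le _ (fixProb K (D \ J) s) _).trans (add_le_add h2 h1)

/-- Both sides are compared with `D ∩ E`. -/
theorem abs_fixProb_sub_le {K : ι → ι → ℝ≥0} (hK : ∀ u, K u u = 1) {D E : Finset ι} {s : ι}
    (hsD : s ∈ D) (hsE : s ∈ E) (hfin : ∀ x, influence K s x ≠ ∞) :
    |fixProb K D s - fixProb K E s| ≤ ∑ x ∈ (D \ E) ∪ (E \ D), (influence K s x).toReal := by
  have h1 := abs_fixProb_sdiff_sub_le hK hsD hfin (D \ E) Finset.sdiff_subset (by simp [hsE])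
  have h2 := abs_fixProb_sdiff_sub_le hK hsE hfin (E \ D) Finset.sdiff_subset (by simp [hsD])
  rw [Finset.sdiff_sdiff_self_left] at h1 h2
  rw [Finset.inter_comm E D] at h2
  rw [Finset.sum_union (Finset.disjoint_of_subset_right Finset.sdiff_subset
    Finset.sdiff_disjoint), abs_sub_comm] at *
  rw [abs_sub_comm] at h1
  rw [abs_le] at *
  constructor <;> linarith [h1.1, h1.2, h2.1, h2.2]

/-- The probability that a random permutation of `D` induces the identity on `C`, which is up to
the weight of `a` also the probability that it induces a given permutation `a` of `C`. -/
noncomputable def avoidProb (K : ι → ι → ℝ≥0) (C D : Finset ι) : ℝ :=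
  zPart K (D \ C) / zPart K D

theorem avoidProb_le_one {K : ι → ι → ℝ≥0} (hK : ∀ u, K u u = 1) (C D : Finset ι) :
    avoidProb K C D ≤ 1 :=
  div_le_one_of_le₀ (by exact_mod_cast zPart_mono hK Finset.sdiff_subset) (by positivity)

/-- Telescoping: `avoidProb K (insert s C) D` is `fixProb K (D \ C) s` times `avoidProb K C D`, and
the first factor is Cauchy because the influences on `s` are summable. -/
theorem exists_tendsto_avoidProb {K : ι → ι → ℝ≥0} (hK : ∀ u, K u u = 1)
    (hinfl : ∀ s, ∑' x, influence K s x < ∞) (C : Finset ι) :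
    ∃ κ : ℝ, Filter.Tendsto (avoidProb K C) Filter.atTop (nhds κ) := by
  induction C using Finset.induction_on with
  | empty =>
    refine ⟨1, tendsto_const_nhds.congr fun D => ?_⟩
    have := one_le_zPart hK D
    rw [avoidProb, Finset.sdiff_empty, div_self]
    exact_mod_cast (zero_lt_one.trans_le this).ne'
  | insert s C hs ih =>
    obtain ⟨κ, hκ⟩ := ih
    have hfin : ∀ x, influence K s x ≠ ∞ := ENNReal.ne_top_of_tsum_ne_top (hinfl s).ne
    have hsum : Summable fun x => (influence K s x).toReal :=
      ENNReal.summable_toReal (hinfl s).ne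
    have hc : CauchySeq fun D : Finset ι => fixProb K (D \ C) s := by
      rw [Metric.cauchySeq_iff]
      intro ε hε
      obtain ⟨F, hF⟩ := summable_iff_vanishing_norm.1 hsum ε hε
      -- Two sets containing `F` differ only outside `F`, where the influences sum to less than `ε`.
      refine ⟨insert s (F ∪ C), fun D hD E hE => ?_⟩
      have hsD : s ∈ D \ C := Finset.mem_sdiff.2 ⟨hD (Finset.mem_insert_self _ _), hs⟩
      have hsE : s ∈ E \ C := Finset.mem_sdiff.2 ⟨hE (Finset.mem_insert_self _ _), hs⟩
      rw [Real.dist_eq]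
      refine (abs_fixProb_sub_le hK hsD hsE hfin).trans_lt ?_
      refine lt_of_le_of_lt (le_abs_self _) (hF _ ?_)
      rw [Finset.disjoint_left]
      intro x hx hxF
      have hxD : x ∈ D := hD (by simp [hxF])
      have hxE : x ∈ E := hE (by simp [hxF])
      simp [hxD, hxE] at hx
    obtain ⟨m, hm⟩ := cauchySeq_tendsto_of_complete hc
    refine ⟨m * κ, (hm.mul hκ).congr fun D => ?_⟩
    rw [fixProb, avoidProb, avoidProb, Finset.sdiff_insert]
    have h1 : (zPart K (D \ C) : ℝ) ≠ 0 := by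
      exact_mod_cast (zero_lt_one.trans_le (one_le_zPart hK _)).ne'
    field_simp

end Influence

/-! ### Mean weight of self-avoiding paths in the Poisson environment. -/

section Annealed

/-- A path through distinct points may visit one site `k` times, and the choices at that site number
a descending factorial. Its Poisson mean is exactly `ρ ^ k`, so repeated visits cost no extra
constant. -/
theorem lintegral_descFactorial_poisson (ρ : ℝ≥0) (k : ℕ) :
    ∫⁻ n, (n.descFactorial k : ℝ≥0∞) ∂(poissonMeasure ρ) = ρ ^ k := by
  rw [poissonMeasure, lintegral_sum_measure]
  simp only [lintegral_smul_measure, lintegral_dirac, smul_eq_mul]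
  rw [← Summable.sum_add_tsum_nat_add' (k := k) ENNReal.summable, Finset.sum_eq_zero, zero_add]
  · have h : ∀ n : ℕ, ENNReal.ofReal (Real.exp (-ρ) * ρ ^ (n + k) / (n + k).factorial) *
        ((n + k).descFactorial k : ℝ≥0∞) =
        ρ ^ k * ENNReal.ofReal (Real.exp (-ρ) * ρ ^ n / n.factorial) := by
      intro n
      have h1 := Nat.factorial_mul_descFactorial (Nat.le_add_left k n)
      rw [Nat.add_sub_cancel] at h1
      rw [← ENNReal.ofReal_natCast, ← ENNReal.ofReal_coe_nnreal, ← ENNReal.ofReal_pow (by simp),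
        ← ENNReal.ofReal_mul (by positivity), ← ENNReal.ofReal_mul (by positivity)]
      congr 1
      rw [← h1]
      have h2 : ((n + k).descFactorial k : ℝ) ≠ 0 := by
        exact_mod_cast (Nat.descFactorial_pos.2 (Nat.le_add_left k n)).ne'
      push_cast
      field_simp
      ring
    simp_rw [h]
    rw [ENNReal.tsum_mul_left, ← ENNReal.ofReal_tsum_of_nonneg (fun n => by positivity)
      (hasSum_one_poissonMeasure ρ).summable, (hasSum_one_poissonMeasure ρ).tsum_eq]
    simp
  · intro n hn
    rw [Nat.descFactorial_of_lt (Finset.mem_range.1 hn)]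
    simp

variable {d : ℕ}

theorem lintegral_prod_descFactorial (ρ : ℝ≥0) (S : Finset (Site d)) (k : Site d → ℕ) :
    ∫⁻ θ, ∏ x ∈ S, ((θ x).descFactorial (k x) : ℝ≥0∞) ∂(envLaw d ρ) = ρ ^ ∑ x ∈ S, k x := by
  have hind := iIndepFun_infinitePi (P := fun _ : Site d => poissonMeasure ρ)
    (X := fun x n => (n.descFactorial (k x) : ℝ≥0∞)) (fun x => by fun_prop)
  have hm : ∀ x : Site d, Measurable fun θ : Site d → ℕ => ((θ x).descFactorial (k x) : ℝ≥0∞) :=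
    fun x => (Measurable.of_discrete (f := fun n : ℕ => (n.descFactorial (k x) : ℝ≥0∞))).comp
      (measurable_pi_apply x)
  have h := lintegral_prod_eq_prod_lintegral_of_indepFun S _ hind hm
  rw [envLaw, h, ← Finset.prod_pow_eq_pow_sum]
  refine Finset.prod_congr rfl fun x _ => ?_
  rw [← lintegral_descFactorial_poisson ρ (k x),
    ← (measurePreserving_eval_infinitePi (fun _ : Site d => poissonMeasure ρ) x).lintegral_comp
      (Measurable.of_discrete (f := fun n : ℕ => (n.descFactorial (k x) : ℝ≥0∞)))]

theorem tsum_points_at_notMem (θ : Site d → ℕ) (x : Site d) {l : List (Points θ)} (hl : l.Nodup) :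
    ∑' p : Points θ, {p : Points θ | p.1 = x ∧ p ∉ l}.indicator (fun _ => (1 : ℝ≥0∞)) p =
      (θ x - (l.map Sigma.fst).count x : ℕ) := by
  have hsplit : ({i : Fin (θ x) | (⟨x, i⟩ : Points θ) ∈ l} : Finset (Fin (θ x))).card =
      (l.map Sigma.fst).count x := by
    have h1 : (l.map Sigma.fst).count x = (l.filter (fun p => p.1 = x)).length := by
      rw [List.count, List.countP_map, List.countP_eq_length_filter]
      congr 1
    rw [h1, ← List.toFinset_card_of_nodup (hl.filter _)]
    refine Finset.card_bij (fun i _ => (⟨x, i⟩ : Points θ)) ?_ ?_ ?_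
    · intro i hi; simpa using hi
    · intro i _ j _ h; simpa using h
    · rintro ⟨y, j⟩ hy
      simp only [List.mem_toFinset, List.mem_filter, decide_eq_true_eq] at hy
      obtain ⟨hy1, rfl⟩ := hy
      exact ⟨j, by simpa using hy1, rfl⟩
  rw [ENNReal.tsum_sigma', tsum_eq_single x]
  · rw [tsum_fintype]
    have : ∀ i : Fin (θ x), {p : Points θ | p.1 = x ∧ p ∉ l}.indicator
        (fun _ => (1 : ℝ≥0∞)) ⟨x, i⟩ =
        if (⟨x, i⟩ : Points θ) ∉ l then 1 else 0 := fun i => by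
      simp [Set.indicator_apply]
    simp_rw [this]
    rw [Finset.sum_boole, Finset.filter_not, Finset.card_sdiff_of_subset (Finset.filter_subset _ _),
      hsplit]
    simp
  · intro y hy
    refine ENNReal.tsum_eq_zero.2 fun i => Set.indicator_of_notMem (fun h => hy h.1) _

/-- The number of ways to lift a list of sites to a list of distinct points. -/
theorem tsum_lifts_le (θ : Site d → ℕ) (S : Finset (Site d)) (m : List (Site d))
    (hm : ∀ x ∈ m, x ∈ S) :
    ∑' l : List (Points θ), {l : List (Points θ) | l.Nodup ∧ l.map Sigma.fst = m}.indicator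
      (fun _ => (1 : ℝ≥0∞)) l ≤ ∏ x ∈ S, ((θ x).descFactorial (m.count x) : ℝ≥0∞) := by
  induction m with
  | nil =>
    rw [tsum_eq_single []]
    · simp
    · intro l hl
      exact Set.indicator_of_notMem (fun h => hl (List.map_eq_nil_iff.1 h.2)) _
  | cons x m ih =>
    have hx : x ∈ S := hm x (by simp)
    rw [tsum_list_eq, Set.indicator_of_notMem (by simp), zero_add, ENNReal.tsum_comm]
    -- The new first point is one of the points at `x` not used by the rest of the list.
    have hcount : ∏ y ∈ S, ((θ y).descFactorial ((x :: m).count y) : ℝ≥0∞) =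
        (θ x - m.count x : ℕ) * ∏ y ∈ S, ((θ y).descFactorial (m.count y) : ℝ≥0∞) := by
      rw [← Finset.mul_prod_erase S _ hx, ← Finset.mul_prod_erase S _ hx, ← mul_assoc]
      congr 1
      · rw [List.count_cons_self, Nat.descFactorial_succ, Nat.cast_mul]
      · refine Finset.prod_congr rfl fun y hy => ?_
        rw [List.count_cons_of_ne (Finset.ne_of_mem_erase hy).symm]
    rw [hcount]
    refine le_trans (le_of_eq ?_) (mul_le_mul_right (ih fun y hy => hm y (by simp [hy])) _)
    rw [← ENNReal.tsum_mul_left]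
    congr 1
    ext l
    by_cases hl : l.Nodup ∧ l.map Sigma.fst = m
    · rw [Set.indicator_of_mem (by exact hl), mul_one, ← hl.2, ← tsum_points_at_notMem θ x hl.1]
      congr 1
      ext p
      simp only [Set.indicator_apply, Set.mem_ofPred_eq, List.nodup_cons, List.map_cons,
        List.cons.injEq]
      congr 1
      simp only [eq_iff_iff]
      tauto
    · rw [Set.indicator_of_notMem (by exact hl), mul_zero]
      refine ENNReal.tsum_eq_zero.2 fun p => Set.indicator_of_notMem (fun h => hl ?_) _
      exact ⟨(List.nodup_cons.1 h.1).2, (List.cons.inj h.2).2⟩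

theorem pathWeight_map {ι κ : Type*} (k : κ → κ → ℝ≥0) (f : ι → κ) (l : List ι) :
    pathWeight (fun u v => k (f u) (f v)) l = pathWeight k (l.map f) := by
  induction l with
  | nil => rfl
  | cons a l ih =>
    cases l with
    | nil => rfl
    | cons b l => simp only [pathWeight, List.map_cons] at *; rw [ih]

theorem tsum_pathWeight_length_le {κ : Type*} (k : κ → κ → ℝ≥0) {φ : ℝ≥0∞}
    (hk : ∀ x, ∑' y, (k x y : ℝ≥0∞) ≤ φ) (n : ℕ) (x : κ) :
    ∑' m : List κ, {m : List κ | m.length = n}.indicator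
      (fun m => (pathWeight k (x :: m) : ℝ≥0∞)) m ≤ φ ^ n := by
  induction n generalizing x with
  | zero =>
    rw [tsum_eq_single []]
    · simp [pathWeight]
    · intro l hl
      exact Set.indicator_of_notMem (by simpa using hl) _
  | succ n ih =>
    rw [tsum_list_eq, Set.indicator_of_notMem (by simp), zero_add, pow_succ']
    refine le_trans ?_ (mul_le_mul_left (hk x) _)
    rw [← ENNReal.tsum_mul_right]
    refine ENNReal.tsum_le_tsum fun c => ?_
    refine le_trans (le_of_eq ?_) (mul_le_mul_right (ih c) _)
    rw [← ENNReal.tsum_mul_left]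
    congr 1
    ext l
    simp only [Set.indicator_apply, Set.mem_ofPred_eq, List.length_cons, add_left_inj, pathWeight,
      ENNReal.coe_mul, mul_ite, mul_zero]

/-- Sorting by length gives a geometric series of ratio `ρ φ`; the additional factor `ρ` belongs to
the starting site. -/
theorem tsum_pathWeight_pow_lt_top {κ : Type*} (k : κ → κ → ℝ≥0) {φ : ℝ≥0∞} {ρ : ℝ≥0}
    (hk : ∀ x, ∑' y, (k x y : ℝ≥0∞) ≤ φ) (h : ρ * φ < 1) (x : κ) :
    ∑' m : List κ, (pathWeight k (x :: m) : ℝ≥0∞) * ρ ^ (m.length + 1) < ∞ := by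
  have h1 : ∀ m : List κ, (pathWeight k (x :: m) : ℝ≥0∞) * ρ ^ (m.length + 1) =
      ∑' n : ℕ, ρ ^ (n + 1) * {m : List κ | m.length = n}.indicator
        (fun m => (pathWeight k (x :: m) : ℝ≥0∞)) m := by
    intro m
    rw [tsum_eq_single m.length]
    · rw [Set.indicator_of_mem (by rfl), mul_comm]
    · intro n hn
      rw [Set.indicator_of_notMem (fun h => hn h.symm), mul_zero]
  simp_rw [h1]
  rw [ENNReal.tsum_comm]
  simp_rw [ENNReal.tsum_mul_left]
  calc ∑' n : ℕ, (ρ : ℝ≥0∞) ^ (n + 1) * ∑' m : List κ, {m : List κ | m.length = n}.indicator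
        (fun m => (pathWeight k (x :: m) : ℝ≥0∞)) m
      ≤ ∑' n : ℕ, ρ * (ρ * φ) ^ n := by
        refine ENNReal.tsum_le_tsum fun n => ?_
        rw [mul_pow, ← mul_assoc, ← pow_succ']
        exact mul_le_mul_right (tsum_pathWeight_length_le k hk n x) _
    _ = ρ * (1 - ρ * φ)⁻¹ := by rw [ENNReal.tsum_mul_left, ENNReal.tsum_geometric]
    _ < ∞ := ENNReal.mul_lt_top ENNReal.coe_lt_top
        (ENNReal.inv_lt_top.2 (tsub_pos_of_lt h))

/-- If `ρ φ < 1`, then almost surely the self-avoiding paths from any point have finite total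
weight. -/
theorem ae_pathTotal_lt_top (k : Site d → Site d → ℝ≥0) {φ : ℝ≥0∞} {ρ : ℝ≥0}
    (hk : ∀ x, ∑' y, (k x y : ℝ≥0∞) ≤ φ) (h : ρ * φ < 1) :
    ∀ᵐ θ ∂(envLaw d ρ), ∀ s : Points θ,
      pathTotal (fun u v : Points θ => k u.1 v.1) s < ∞ := by
  have hmeas : ∀ (x : Site d) (m : List (Site d)), Measurable fun θ : Site d → ℕ =>
      ∏ y ∈ (x :: m).toFinset, ((θ y).descFactorial ((x :: m).count y) : ℝ≥0∞) := fun x m =>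
    Finset.measurable_prod _ fun y _ =>
      (Measurable.of_discrete (f := fun n : ℕ => (n.descFactorial ((x :: m).count y) : ℝ≥0∞))).comp
        (measurable_pi_apply y)
  have hx : ∀ x : Site d, ∀ᵐ θ ∂(envLaw d ρ),
      ∑' m : List (Site d), (pathWeight k (x :: m) : ℝ≥0∞) *
        ∏ y ∈ (x :: m).toFinset, ((θ y).descFactorial ((x :: m).count y) : ℝ≥0∞) < ∞ := by
    intro x
    refine ae_lt_top (Measurable.tsum fun m => (hmeas x m).const_mul _) ?_
    rw [lintegral_tsum fun m => ((hmeas x m).const_mul _).aemeasurable]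
    refine (lt_of_eq_of_lt ?_ (tsum_pathWeight_pow_lt_top k hk h x)).ne
    congr 1
    ext m
    rw [lintegral_const_mul _ (hmeas x m), lintegral_prod_descFactorial,
      List.sum_toFinset_count_eq_length, List.length_cons]
  filter_upwards [ae_all_iff.2 hx] with θ hθ
  rintro ⟨x, i⟩
  refine lt_of_le_of_lt ?_ (hθ x)
  set s : Points θ := ⟨x, i⟩
  -- Paths of points are grouped by the list of sites they visit, which alone determines their
  -- weight.
  have h1 : pathTotal (fun u v : Points θ => k u.1 v.1) s =
      ∑' l : List (Points θ), ∑' m : List (Site d), (pathWeight k (x :: m) : ℝ≥0∞) *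
        {l : List (Points θ) | l.Nodup ∧ l.map Sigma.fst = x :: m}.indicator
          (fun _ => (1 : ℝ≥0∞)) (s :: l) := by
    unfold pathTotal
    congr 1
    ext l
    rw [tsum_eq_single (l.map Sigma.fst)]
    · have hw : ∀ l, pathWeight (fun u v : Points θ => k u.1 v.1) (s :: l) =
          pathWeight k (x :: l.map Sigma.fst) := fun l => pathWeight_map k Sigma.fst (s :: l)
      simp [Set.indicator_apply, s, hw]
    · intro m hm
      rw [Set.indicator_of_notMem, mul_zero]
      rintro ⟨-, h⟩
      exact hm (List.cons.inj h).2.symm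
  rw [h1, ENNReal.tsum_comm]
  refine ENNReal.tsum_le_tsum fun m => ?_
  rw [ENNReal.tsum_mul_left]
  refine mul_le_mul_right (le_trans ?_ (tsum_lifts_le θ _ (x :: m) fun y hy => by
    exact List.mem_toFinset.2 hy)) _
  -- The lifts starting at `s` are bounded by the lifts starting at any point over `x`.
  exact ENNReal.tsum_comp_le_tsum_of_injective (List.cons_injective (a := s))
    ({l : List (Points θ) | l.Nodup ∧ l.map Sigma.fst = x :: m}.indicator (fun _ => (1 : ℝ≥0∞)))

end Annealed

/-! ### Permutations of a finite subset. -/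

section Perms

variable {ι : Type*} [DecidableEq ι]

theorem mem_perms_iff {D : Finset ι} {τ : Equiv.Perm ι} :
    τ ∈ permsOfFinset D ↔ ∀ x ∉ D, τ x = x := by
  rw [mem_perms_of_finset_iff]
  exact ⟨fun h x hx => by_contra fun h' => hx (h h'), fun h x hx => by_contra fun h' => hx (h x h')⟩

theorem perms_apply_mem {D : Finset ι} {τ : Equiv.Perm ι} (h : τ ∈ permsOfFinset D) {x : ι} :
    τ x ∈ D ↔ x ∈ D := by
  rw [mem_perms_iff] at h
  constructor
  · intro hx
    by_contra hxD
    rw [h x hxD] at hx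
    exact hxD hx
  · intro hx
    by_contra hxD
    have := h _ hxD
    rw [τ.injective this] at hxD
    exact hxD hx

theorem perms_mul {D : Finset ι} {σ τ : Equiv.Perm ι} (hσ : σ ∈ permsOfFinset D)
    (hτ : τ ∈ permsOfFinset D) : σ * τ ∈ permsOfFinset D := by
  rw [mem_perms_iff] at *
  intro x hx
  rw [Equiv.Perm.mul_apply, hτ x hx, hσ x hx]

theorem perms_inv {D : Finset ι} {σ : Equiv.Perm ι} (hσ : σ ∈ permsOfFinset D) :
    σ⁻¹ ∈ permsOfFinset D := by
  rw [mem_perms_iff] at *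
  intro x hx
  rw [Equiv.Perm.inv_eq_iff_eq, hσ x hx]

theorem perms_mono {C D : Finset ι} (h : C ⊆ D) {σ : Equiv.Perm ι} (hσ : σ ∈ permsOfFinset C) :
    σ ∈ permsOfFinset D := by
  rw [mem_perms_iff] at *
  exact fun x hx => hσ x fun hC => hx (h hC)

theorem perms_image {D : Finset ι} {σ : Equiv.Perm ι} (h : ∀ x ∈ D, σ x ∈ D) : D.image σ = D := by
  refine Finset.eq_of_subset_of_card_le ?_ (Finset.card_image_of_injective D σ.injective).ge
  intro y hy
  obtain ⟨x, hx, rfl⟩ := Finset.mem_image.1 hy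
  exact h x hx

/-- A permutation that maps the finite set `D` into itself agrees on `D` with a permutation
of `D`. -/
theorem exists_perms_eqOn {D : Finset ι} {σ : Equiv.Perm ι} (h : ∀ x ∈ D, σ x ∈ D) :
    ∃ b ∈ permsOfFinset D, ∀ x ∈ D, b x = σ x := by
  have h' : ∀ x, σ x ∈ D ↔ x ∈ D := by
    intro x
    refine ⟨fun hx => ?_, h x⟩
    rw [← perms_image h] at hx
    obtain ⟨y, hy, hyx⟩ := Finset.mem_image.1 hx
    rwa [← σ.injective hyx]
  refine ⟨Equiv.Perm.ofSubtype (σ.subtypePerm h'), mem_perms_iff.2 fun x hx => ?_, fun x hx => ?_⟩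
  · exact Equiv.Perm.ofSubtype_apply_of_not_mem _ hx
  · exact Equiv.Perm.ofSubtype_apply_of_mem _ hx

theorem sum_perms_comp (K : ι → ι → ℝ≥0) {D : Finset ι} {σ : Equiv.Perm ι}
    (h : ∀ x ∈ D, σ x ∈ D) :
    ∑ τ ∈ permsOfFinset D, ∏ u ∈ D, K u (σ (τ u)) = zPart K D := by
  rw [sum_perms_eq_per K D σ σ.injective.injOn, perms_image h, zPart]

/-- The permutations in the sum are the products `a * τ` with `τ` a permutation of `D \ C`, and the
weight factorizes. -/
theorem sum_perms_eqOn (K : ι → ι → ℝ≥0) {C D : Finset ι} (hCD : C ⊆ D) {a : Equiv.Perm ι}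
    (ha : a ∈ permsOfFinset C) :
    ∑ c ∈ permsOfFinset D with ∀ u ∈ C, c u = a u, ∏ u ∈ D, K u (c u) =
      (∏ u ∈ C, K u (a u)) * zPart K (D \ C) := by
  have hpres : ∀ x ∈ D \ C, a x ∈ D \ C := by
    intro x hx
    rwa [mem_perms_iff.1 ha x (Finset.mem_sdiff.1 hx).2]
  rw [← sum_perms_comp K hpres, Finset.mul_sum]
  symm
  refine Finset.sum_bij' (fun τ _ => a * τ) (fun c _ => a⁻¹ * c) ?_ ?_ ?_ ?_ ?_
  · intro τ hτ
    refine Finset.mem_filter.2 ⟨perms_mul (perms_mono hCD ha) (perms_mono Finset.sdiff_subset hτ),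
      fun u hu => ?_⟩
    rw [Equiv.Perm.mul_apply, mem_perms_iff.1 hτ u (by simp [hu])]
  · intro c hc
    rw [Finset.mem_filter] at hc
    refine mem_perms_iff.2 fun x hx => ?_
    rw [Equiv.Perm.mul_apply, Equiv.Perm.inv_eq_iff_eq]
    by_cases hxC : x ∈ C
    · exact hc.2 x hxC
    · rw [mem_perms_iff.1 ha x hxC]
      exact mem_perms_iff.1 hc.1 x fun hxD => hx (Finset.mem_sdiff.2 ⟨hxD, hxC⟩)
  · intro τ _; simp
  · intro c _; simp
  · intro τ hτ
    rw [← Finset.prod_sdiff hCD, mul_comm]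
    congr 1
    refine Finset.prod_congr rfl fun u hu => ?_
    rw [Equiv.Perm.mul_apply, mem_perms_iff.1 hτ u (by simp [hu])]

end Perms

/-! ### The specification as a random permutation of the inner points. -/

section Specification

variable {d : ℕ} (V : EuclideanSpace ℝ (Fin d) → ℝ) (α : ℝ) (θ : Site d → ℕ)

/-- The weight of a jump from the site `x` to the site `y`. -/
noncomputable def siteKernel (x y : Site d) : ℝ≥0 :=
  Real.toNNReal (Real.exp (-α * V (toReal y - toReal x)))

/-- The weight of a jump from the point `u` to the point `v`. -/
noncomputable def kern (u v : Points θ) : ℝ≥0 := siteKernel V α u.1 v.1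

theorem kern_pos (u v : Points θ) : 0 < kern V α θ u v := by
  simp [kern, siteKernel, Real.exp_pos]

/-- The points over the sites of `Λ`. -/
def box (Λ : Finset (Site d)) : Finset (Points θ) := Λ.sigma fun _ => Finset.univ

variable {θ}

theorem mem_box {Λ : Finset (Site d)} {u : Points θ} : u ∈ box θ Λ ↔ u.1 ∈ Λ := by
  simp [box]

theorem boltzmann_eq (Λ : Finset (Site d)) (σ : Equiv.Perm (Points θ)) :
    boltzmann V α θ Λ σ = ((∏ u ∈ box θ Λ, kern V α θ u (σ u) : ℝ≥0) : ℝ≥0∞) := by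
  rw [boltzmann, hamiltonian, Finset.mul_sum, Real.exp_sum, box, Finset.prod_sigma,
    ENNReal.ofReal]
  congr 1
  rw [Real.toNNReal_prod_of_nonneg (fun x _ => (Real.exp_pos _).le)]
  refine Finset.prod_congr rfl fun x _ => ?_
  rw [Finset.mul_sum, Real.exp_sum, Real.toNNReal_prod_of_nonneg (fun x _ => (Real.exp_pos _).le)]
  rfl

open Classical in
/-- The points whose orbit under `ξ` stays over `Λ`. -/
noncomputable def inner (Λ : Finset (Site d)) (ξ : Equiv.Perm (Points θ)) : Finset (Points θ) :=
  {u ∈ box θ Λ | ∀ n : ℤ, (ξ ^ n) u ∈ box θ Λ}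

theorem mem_inner {Λ : Finset (Site d)} {ξ : Equiv.Perm (Points θ)} {u : Points θ} :
    u ∈ inner Λ ξ ↔ ∀ n : ℤ, (ξ ^ n) u ∈ box θ Λ := by
  simp only [inner, Finset.mem_filter, and_iff_right_iff_imp]
  exact fun h => h 0

theorem inner_subset (Λ : Finset (Site d)) (ξ : Equiv.Perm (Points θ)) :
    inner Λ ξ ⊆ box θ Λ := fun _ hu => mem_inner.1 hu 0

theorem zpow_mem_inner {Λ : Finset (Site d)} {ξ : Equiv.Perm (Points θ)} {u : Points θ} (n : ℤ) :
    (ξ ^ n) u ∈ inner Λ ξ ↔ u ∈ inner Λ ξ := by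
  have key : ∀ (m : ℤ) (v : Points θ), v ∈ inner Λ ξ → (ξ ^ m) v ∈ inner Λ ξ := by
    intro m v hv
    rw [mem_inner] at *
    intro k
    rw [← Equiv.Perm.mul_apply, ← zpow_add]
    exact hv _
  refine ⟨fun h => ?_, key n u⟩
  have := key (-n) _ h
  rwa [← Equiv.Perm.mul_apply, ← zpow_add, neg_add_cancel, zpow_zero, Equiv.Perm.one_apply] at this

theorem apply_mem_inner {Λ : Finset (Site d)} {ξ : Equiv.Perm (Points θ)} {u : Points θ} :
    ξ u ∈ inner Λ ξ ↔ u ∈ inner Λ ξ := by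
  simpa using zpow_mem_inner (ξ := ξ) (u := u) (Λ := Λ) 1

/-- The boundary condition freezes every orbit that leaves `Λ`, including its part over `Λ`. What
remains free is a permutation of the points whose orbit stays over `Λ`. -/
theorem mem_compatible_iff {Λ : Finset (Site d)} {ξ σ : Equiv.Perm (Points θ)} :
    σ ∈ compatible θ Λ ξ ↔ ξ⁻¹ * σ ∈ permsOfFinset (inner Λ ξ) := by
  rw [mem_perms_iff]
  constructor
  · intro h s hs
    rw [mem_inner, not_forall] at hs
    obtain ⟨n, hn⟩ := hs
    -- Agreement of all powers at the outside point `v` is carried back along the orbit to `s`.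
    set v := (ξ ^ n) s with hv
    have hv' := h v (fun hΛ => hn (mem_box.2 hΛ))
    have h1 : s = (σ ^ (-n)) v := by
      rw [hv' (-n), hv, ← Equiv.Perm.mul_apply, ← zpow_add, neg_add_cancel, zpow_zero,
        Equiv.Perm.one_apply]
    have h2 : s = (ξ ^ (-n)) v := by rw [← hv' (-n), ← h1]
    rw [Equiv.Perm.mul_apply, Equiv.Perm.inv_eq_iff_eq]
    calc σ s = (σ ^ (1 + -n)) v := by rw [zpow_one_add, Equiv.Perm.mul_apply, ← h1]
      _ = (ξ ^ (1 + -n)) v := hv' _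
      _ = ξ s := by rw [zpow_one_add, Equiv.Perm.mul_apply, ← h2]
  · intro h s hs n
    have hs' : s ∉ inner Λ ξ := fun hi => hs (mem_box.1 (inner_subset Λ ξ hi))
    have hσ : ∀ u ∉ inner Λ ξ, σ u = ξ u := by
      intro u hu
      have := h u hu
      rwa [Equiv.Perm.mul_apply, Equiv.Perm.inv_eq_iff_eq] at this
    have hσ' : ∀ u ∉ inner Λ ξ, σ⁻¹ u = ξ⁻¹ u := by
      intro u hu
      have h2 : ξ⁻¹ u ∉ inner Λ ξ := by
        rw [← zpow_neg_one, zpow_mem_inner]; exact hu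
      rw [Equiv.Perm.inv_eq_iff_eq, hσ _ h2]; simp
    induction n with
    | zero => rfl
    | succ n ih =>
      rw [add_comm, zpow_one_add, zpow_one_add, Equiv.Perm.mul_apply, Equiv.Perm.mul_apply, ih,
        hσ _ (by rwa [zpow_mem_inner])]
    | pred n ih =>
      rw [sub_eq_neg_add, zpow_add, zpow_add, Equiv.Perm.mul_apply, Equiv.Perm.mul_apply, ih,
        zpow_neg_one, zpow_neg_one, hσ' _ (by rwa [zpow_mem_inner])]

theorem inner_eq_of_compatible {Λ : Finset (Site d)} {ξ σ : Equiv.Perm (Points θ)}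
    (h : σ ∈ compatible θ Λ ξ) : inner Λ σ = inner Λ ξ := by
  have key : ∀ (f g : Equiv.Perm (Points θ)), g ∈ compatible θ Λ f → inner Λ g ⊆ inner Λ f := by
    intro f g hfg u hu
    rw [mem_inner] at *
    intro n
    by_contra hn
    have h1 := hfg _ (fun hΛ => hn (mem_box.2 hΛ)) (-n)
    rw [← Equiv.Perm.mul_apply (f ^ (-n)), ← zpow_add, neg_add_cancel, zpow_zero,
      Equiv.Perm.one_apply] at h1
    refine hn ?_
    have h2 := hu n
    rw [← h1, ← Equiv.Perm.mul_apply, ← zpow_add, add_neg_cancel, zpow_zero,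
      Equiv.Perm.one_apply] at h2
    exact h2
  exact Finset.Subset.antisymm (key _ _ h) (key _ _ fun s hs n => (h s hs n).symm)

theorem tsum_compatible (Λ : Finset (Site d)) (ξ : Equiv.Perm (Points θ))
    (f : Equiv.Perm (Points θ) → ℝ≥0∞) :
    ∑' σ : compatible θ Λ ξ, f σ = ∑ τ ∈ permsOfFinset (inner Λ ξ), f (ξ * τ) := by
  let e : {τ // τ ∈ permsOfFinset (inner Λ ξ)} ≃ compatible θ Λ ξ :=
    { toFun := fun τ => ⟨ξ * τ, mem_compatible_iff.2 (by simp)⟩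
      invFun := fun σ => ⟨ξ⁻¹ * σ, mem_compatible_iff.1 σ.2⟩
      left_inv := fun τ => by simp
      right_inv := fun σ => by simp }
  rw [← e.tsum_eq]
  exact Finset.tsum_subtype (permsOfFinset (inner Λ ξ)) fun τ => f (ξ * τ)

theorem boltzmann_mul (Λ : Finset (Site d)) {ξ τ : Equiv.Perm (Points θ)}
    (hτ : τ ∈ permsOfFinset (inner Λ ξ)) :
    boltzmann V α θ Λ (ξ * τ) =
      ((∏ u ∈ box θ Λ \ inner Λ ξ, kern V α θ u (ξ u) : ℝ≥0) : ℝ≥0∞) *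
        (∏ u ∈ inner Λ ξ, kern V α θ u (ξ (τ u)) : ℝ≥0) := by
  rw [boltzmann_eq, ← Finset.prod_sdiff (inner_subset Λ ξ), ENNReal.coe_mul]
  congr 2
  refine Finset.prod_congr rfl fun u hu => ?_
  rw [Equiv.Perm.mul_apply, mem_perms_iff.1 hτ u (Finset.mem_sdiff.1 hu).2]

theorem partitionFunction_eq (Λ : Finset (Site d)) (ξ : Equiv.Perm (Points θ)) :
    partitionFunction V α θ Λ ξ =
      ((∏ u ∈ box θ Λ \ inner Λ ξ, kern V α θ u (ξ u) : ℝ≥0) : ℝ≥0∞) *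
        zPart (kern V α θ) (inner Λ ξ) := by
  rw [partitionFunction, tsum_compatible Λ ξ (boltzmann V α θ Λ),
    ← sum_perms_comp (σ := ξ) _ fun u => apply_mem_inner.2, ENNReal.ofNNReal_finsetSum,
    Finset.mul_sum]
  exact Finset.sum_congr rfl fun τ hτ => boltzmann_mul V α Λ hτ

-- The jumps from `box θ Λ \ inner Λ ξ` are frozen, so their common positive weight cancels against
-- the partition function.
open Classical in
theorem specification_apply (Λ : Finset (Site d)) (ξ : Equiv.Perm (Points θ))
    {A : Set (Equiv.Perm (Points θ))} (hA : MeasurableSet A) :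
    specification V α θ Λ ξ A =
      ((∑ τ ∈ permsOfFinset (inner Λ ξ) with ξ * τ ∈ A,
        ∏ u ∈ inner Λ ξ, kern V α θ u (ξ (τ u)) : ℝ≥0) : ℝ≥0∞) /
          zPart (kern V α θ) (inner Λ ξ) := by
  rw [specification, Measure.sum_apply _ hA]
  simp only [Measure.smul_apply, Measure.dirac_apply' _ hA, smul_eq_mul]
  rw [tsum_compatible Λ ξ (fun σ => boltzmann V α θ Λ σ / partitionFunction V α θ Λ ξ *
    A.indicator 1 σ), Finset.sum_filter, ENNReal.ofNNReal_finsetSum, partitionFunction_eq,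
    div_eq_mul_inv, Finset.sum_mul]
  refine Finset.sum_congr rfl fun τ hτ => ?_
  rw [boltzmann_mul V α Λ hτ]
  have hc : ((∏ u ∈ box θ Λ \ inner Λ ξ, kern V α θ u (ξ u) : ℝ≥0) : ℝ≥0∞) ≠ 0 := by
    rw [ENNReal.coe_ne_zero]
    exact (Finset.prod_pos fun u _ => kern_pos V α θ _ _).ne'
  rw [ENNReal.mul_div_mul_left _ _ hc ENNReal.coe_ne_top]
  by_cases h : ξ * τ ∈ A
  · simp [h, div_eq_mul_inv]
  · simp [h]

end Specification

/-! ### Topology and measurable structure of the space of permutations. -/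

section PermSpace

variable {d : ℕ} {θ : Site d → ℕ}

instance : BorelSpace (Equiv.Perm (Points θ)) := ⟨rfl⟩

theorem isOpen_apply_mem (s : Points θ) (U : Set (Points θ)) :
    IsOpen {σ : Equiv.Perm (Points θ) | σ s ∈ U} := by
  have hle : permTopology θ ≤
      TopologicalSpace.induced (fun σ : Equiv.Perm (Points θ) => σ s) ⊥ := iInf_le _ s
  exact hle _ ⟨U, trivial, rfl⟩

theorem isClopen_apply_eq (s t : Points θ) :
    IsClopen {σ : Equiv.Perm (Points θ) | σ s = t} :=
  ⟨⟨isOpen_apply_mem s {t}ᶜ⟩, isOpen_apply_mem s {t}⟩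

instance : T2Space (Equiv.Perm (Points θ)) := by
  refine ⟨fun σ τ h => ?_⟩
  obtain ⟨s, hs⟩ : ∃ s, σ s ≠ τ s := by
    by_contra! h'; exact h (Equiv.ext h')
  refine ⟨_, _, (isClopen_apply_eq s (σ s)).isOpen, (isClopen_apply_eq s (τ s)).isOpen, rfl,
    rfl, ?_⟩
  rw [Set.disjoint_left]
  intro ρ h1 h2
  exact hs (h1.symm.trans h2)

theorem tendsto_nhds_perm {l : Filter (Equiv.Perm (Points θ))} {σ : Equiv.Perm (Points θ)}
    (h : ∀ s, ∀ᶠ τ in l, τ s = σ s) : l ≤ nhds σ := by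
  rw [permTopology, nhds_iInf]
  refine le_iInf fun s => ?_
  rw [@nhds_induced _ _ ⊥ (fun σ : Equiv.Perm (Points θ) => σ s) σ, ← Filter.tendsto_iff_comap,
    @nhds_discrete _ ⊥ (@DiscreteTopology.mk _ ⊥ rfl)]
  exact Filter.tendsto_pure.2 (h s)

/-- Along an ultrafilter, a point confined to a finite set is eventually constant. The inverse must
be confined as well, so that the pointwise limit is again a bijection. -/
theorem isCompact_perm_of_finite (F : Points θ → Finset (Points θ)) :
    IsCompact {σ : Equiv.Perm (Points θ) | ∀ s, σ s ∈ F s ∧ σ⁻¹ s ∈ F s} := by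
  rw [isCompact_iff_ultrafilter_le_nhds]
  intro l hl
  rw [Filter.le_principal_iff] at hl
  have key : ∀ (f : Equiv.Perm (Points θ) → Points θ) (G : Finset (Points θ)),
      (∀ᶠ σ in (l : Filter _), f σ ∈ G) → ∃ t, ∀ᶠ σ in (l : Filter _), f σ = t := by
    intro f G h
    have : ∀ᶠ σ in (l : Filter _), ∃ t ∈ G, f σ = t := h.mono fun σ hσ => ⟨_, hσ, rfl⟩
    obtain ⟨t, -, ht⟩ := (Ultrafilter.eventually_exists_mem_iff G.finite_toSet).1 this
    exact ⟨t, ht⟩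
  have h1 : ∀ s, ∃ t, ∀ᶠ σ : Equiv.Perm (Points θ) in (l : Filter _), σ s = t := fun s =>
    key (fun σ => σ s) (F s) (Filter.mem_of_superset hl fun σ hσ => (hσ s).1)
  have h2 : ∀ s, ∃ t, ∀ᶠ σ : Equiv.Perm (Points θ) in (l : Filter _), σ⁻¹ s = t := fun s =>
    key (fun σ => σ⁻¹ s) (F s) (Filter.mem_of_superset hl fun σ hσ => (hσ s).2)
  choose f hf using h1
  choose g hg using h2
  let σ₀ : Equiv.Perm (Points θ) :=
    { toFun := f
      invFun := g
      left_inv := fun s => by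
        obtain ⟨σ, h1, h2⟩ := ((hf s).and (hg (f s))).exists
        rw [← h2, ← h1]; simp
      right_inv := fun s => by
        obtain ⟨σ, h1, h2⟩ := ((hg s).and (hf (g s))).exists
        rw [← h2, ← h1]; simp }
  refine ⟨σ₀, fun s => ?_, tendsto_nhds_perm hf⟩
  constructor
  · obtain ⟨σ, h1, h2⟩ := ((hf s).and (Filter.eventually_mem_set.2 hl)).exists
    change f s ∈ F s
    rw [← h1]; exact (h2 s).1
  · obtain ⟨σ, h1, h2⟩ := ((hg s).and (Filter.eventually_mem_set.2 hl)).exists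
    change g s ∈ F s
    rw [← h1]; exact (h2 s).2

theorem permMeasurableSpace_eq : permMeasurableSpace θ =
    ⨆ s : Points θ, MeasurableSpace.comap (fun σ : Equiv.Perm (Points θ) => σ s) ⊤ := by
  let _ : TopologicalSpace (Points θ) := ⊥
  have _ : DiscreteTopology (Points θ) := ⟨rfl⟩
  let _ : MeasurableSpace (Points θ) := ⊤
  have htop : permTopology θ =
      TopologicalSpace.induced (fun (σ : Equiv.Perm (Points θ)) (s : Points θ) => σ s)
        Pi.topologicalSpace := by
    rw [permTopology, Pi.topologicalSpace, induced_iInf]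
    simp only [induced_compose]
    rfl
  rw [permMeasurableSpace, htop, borel_comap,
    ← (inferInstance : BorelSpace (Points θ → Points θ)).measurable_eq, MeasurableSpace.pi,
    MeasurableSpace.comap_iSup]
  simp only [MeasurableSpace.comap_comp]
  rfl

/-- The permutations that agree with `a` on `C`. -/
def cyl (C : Finset (Points θ)) (a : Equiv.Perm (Points θ)) : Set (Equiv.Perm (Points θ)) :=
  {σ | ∀ u ∈ C, σ u = a u}

theorem isClopen_cyl (C : Finset (Points θ)) (a : Equiv.Perm (Points θ)) :
    IsClopen (cyl C a) := by
  have : cyl C a = ⋂ u ∈ C, {σ | σ u = a u} := by ext; simp [cyl]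
  rw [this]
  exact isClopen_biInter_finset fun u _ => isClopen_apply_eq u (a u)

theorem measurableSet_cyl (C : Finset (Points θ)) (a : Equiv.Perm (Points θ)) :
    MeasurableSet (cyl C a) := (isClopen_cyl C a).isOpen.measurableSet

/-- The cylinders over the invariant finite sets that contain `D`. -/
def cylinders (D : Finset (Points θ)) : Set (Set (Equiv.Perm (Points θ))) :=
  {A | ∃ C a, D ⊆ C ∧ a ∈ permsOfFinset C ∧ A = cyl C a}

/-- A permutation in both cylinders leaves `C₁ ∪ C₂` invariant, so the intersection is the cylinder
over the union. -/
theorem isPiSystem_cylinders (D : Finset (Points θ)) : IsPiSystem (cylinders D) := by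
  rintro _ ⟨C₁, a₁, hD₁, ha₁, rfl⟩ _ ⟨C₂, a₂, hD₂, ha₂, rfl⟩ ⟨σ, h1, h2⟩
  have hσ : ∀ x ∈ C₁ ∪ C₂, σ x ∈ C₁ ∪ C₂ := by
    intro x hx
    rcases Finset.mem_union.1 hx with hx | hx
    · rw [h1 x hx]; exact Finset.mem_union_left _ ((perms_apply_mem ha₁).2 hx)
    · rw [h2 x hx]; exact Finset.mem_union_right _ ((perms_apply_mem ha₂).2 hx)
  obtain ⟨b, hb, hbσ⟩ := exists_perms_eqOn hσ
  refine ⟨C₁ ∪ C₂, b, hD₁.trans Finset.subset_union_left, hb, ?_⟩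
  ext τ
  simp only [cyl, Set.mem_inter_iff, Set.mem_ofPred_eq, Finset.mem_union]
  constructor
  · rintro ⟨k1, k2⟩ u hu
    rw [hbσ u (Finset.mem_union.2 hu)]
    rcases hu with hu | hu
    · rw [k1 u hu, h1 u hu]
    · rw [k2 u hu, h2 u hu]
  · intro k
    refine ⟨fun u hu => ?_, fun u hu => ?_⟩
    · rw [k u (Or.inl hu), hbσ u (Finset.mem_union_left _ hu), h1 u hu]
    · rw [k u (Or.inr hu), hbσ u (Finset.mem_union_right _ hu), h2 u hu]

theorem IsFiniteCycle.exists_invariant {σ : Equiv.Perm (Points θ)} (h : IsFiniteCycle σ)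
    (F : Finset (Points θ)) : ∃ C : Finset (Points θ), F ⊆ C ∧ ∀ x ∈ C, σ x ∈ C := by
  choose n hn0 hn using h
  refine ⟨F.biUnion fun s => (Finset.range (n s)).image fun k => (σ ^ k) s, fun s hs => ?_, ?_⟩
  · refine Finset.mem_biUnion.2 ⟨s, hs, Finset.mem_image.2 ⟨0, Finset.mem_range.2 (hn0 s), rfl⟩⟩
  · intro x hx
    obtain ⟨s, hs, hx⟩ := Finset.mem_biUnion.1 hx
    obtain ⟨k, hk, rfl⟩ := Finset.mem_image.1 hx
    refine Finset.mem_biUnion.2 ⟨s, hs, Finset.mem_image.2 ?_⟩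
    rw [Finset.mem_range] at hk
    rcases Nat.lt_or_ge (k + 1) (n s) with h | h
    · exact ⟨k + 1, Finset.mem_range.2 h, by rw [pow_succ', Equiv.Perm.mul_apply]⟩
    · have : k + 1 = n s := le_antisymm hk h
      refine ⟨0, Finset.mem_range.2 (hn0 s), ?_⟩
      rw [← Equiv.Perm.mul_apply, ← pow_succ', this, hn s, pow_zero, Equiv.Perm.one_apply]

/-- Every finite set lies in a finite invariant set of a finite cycle permutation. Hence the
cylinders over large invariant sets generate the Borel structure induced on the finite cycle
permutations. -/
theorem exists_generateFrom_cylinders (D : Finset (Points θ)) {B : Set (Equiv.Perm (Points θ))}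
    (hB : MeasurableSet B) :
    ∃ B', MeasurableSet[MeasurableSpace.generateFrom (cylinders D)] B' ∧
      ∀ σ, IsFiniteCycle σ → (σ ∈ B ↔ σ ∈ B') := by
  let val : {σ : Equiv.Perm (Points θ) // IsFiniteCycle σ} → Equiv.Perm (Points θ) := Subtype.val
  have hle : permMeasurableSpace θ ≤ MeasurableSpace.map val
      (MeasurableSpace.comap val (MeasurableSpace.generateFrom (cylinders D))) := by
    rw [permMeasurableSpace_eq]
    refine iSup_le fun s => ?_
    rw [← measurable_iff_comap_le]
    let _ : MeasurableSpace (Points θ) := ⊤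
    refine @measurable_to_countable' (Points θ) _ _ _
      (MeasurableSpace.map val (MeasurableSpace.comap val
        (MeasurableSpace.generateFrom (cylinders D)))) _ fun t => ?_
    -- On finite cycle permutations, the event `σ s = t` is this countable union of cylinders.
    refine ⟨⋃ C : {C : Finset (Points θ) // D ⊆ C ∧ s ∈ C},
      ⋃ a : {a // a ∈ permsOfFinset C.1 ∧ a s = t}, cyl C.1 a.1, ?_, ?_⟩
    · refine MeasurableSet.iUnion fun C => ?_
      have _ : Finite {a // a ∈ permsOfFinset C.1 ∧ a s = t} :=
        Set.Finite.to_subtype ((permsOfFinset C.1).finite_toSet.subset fun a ha => ha.1)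
      exact MeasurableSet.iUnion fun a =>
        MeasurableSpace.measurableSet_generateFrom ⟨C.1, a.1, C.2.1, a.2.1, rfl⟩
    · ext ⟨σ, hσ⟩
      simp only [Set.mem_preimage, Set.mem_iUnion, val, Set.mem_singleton_iff]
      constructor
      · rintro ⟨⟨C, hC⟩, ⟨a, ha⟩, h⟩
        rw [h s hC.2]; exact ha.2
      · intro h
        obtain ⟨C, hC, hinv⟩ := hσ.exists_invariant (insert s D)
        obtain ⟨b, hb, hbσ⟩ := exists_perms_eqOn hinv
        have hs : s ∈ C := hC (Finset.mem_insert_self _ _)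
        exact ⟨⟨C, (Finset.subset_insert _ _).trans hC, hs⟩, ⟨b, hb, by rw [hbσ s hs, h]⟩,
          fun u hu => (hbσ u hu).symm⟩
  obtain ⟨B', hB', h⟩ := hle B hB
  refine ⟨B', hB', fun σ hσ => ?_⟩
  exact (Set.ext_iff.1 h ⟨σ, hσ⟩).symm

theorem generateFrom_cylinders_le (D : Finset (Points θ)) :
    MeasurableSpace.generateFrom (cylinders D) ≤ permMeasurableSpace θ := by
  refine MeasurableSpace.generateFrom_le ?_
  rintro _ ⟨C, a, -, -, rfl⟩
  exact measurableSet_cyl C a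

/-- Finite cycle probability measures are determined by the probabilities of the cylinders over
invariant finite sets. -/
theorem ext_of_cyl {μ ν : Measure (Equiv.Perm (Points θ))} [IsProbabilityMeasure μ]
    [IsProbabilityMeasure ν] (hμ : ∀ᵐ σ ∂μ, IsFiniteCycle σ) (hν : ∀ᵐ σ ∂ν, IsFiniteCycle σ)
    (h : ∀ C, ∀ a ∈ permsOfFinset C, μ (cyl C a) = ν (cyl C a)) : μ = ν := by
  refine Measure.ext fun B hB => ?_
  obtain ⟨B', hB', hBB'⟩ := exists_generateFrom_cylinders ∅ hB
  have h1 : μ B = μ B' := measure_congr (hμ.mono fun σ hσ => propext (hBB' σ hσ))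
  have h2 : ν B = ν B' := measure_congr (hν.mono fun σ hσ => propext (hBB' σ hσ))
  rw [h1, h2]
  clear h1 h2 hBB'
  induction B', hB' using MeasurableSpace.induction_on_inter rfl (isPiSystem_cylinders ∅) with
  | empty => simp
  | basic A hA =>
    obtain ⟨C, a, -, ha, rfl⟩ := hA
    exact h C a ha
  | compl A hA ih =>
    have hA' := generateFrom_cylinders_le ∅ A hA
    rw [prob_compl_eq_one_sub hA', prob_compl_eq_one_sub hA', ih]
  | iUnion f hd hf ih =>
    have hf' := fun i => generateFrom_cylinders_le ∅ (f i) (hf i)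
    rw [measure_iUnion hd hf', measure_iUnion hd hf']
    exact tsum_congr ih

end PermSpace

/-! ### Cylinder probabilities of a finite cycle Gibbs measure. -/

section Uniqueness

theorem zpow_apply_mem_of_mapsTo {ι : Type*} [DecidableEq ι] {D : Finset ι} {σ : Equiv.Perm ι}
    (h : ∀ x ∈ D, σ x ∈ D) (n : ℤ) {x : ι} (hx : x ∈ D) : (σ ^ n) x ∈ D := by
  have h' : ∀ x ∈ D, σ⁻¹ x ∈ D := by
    intro x hx
    rw [← perms_image h] at hx
    obtain ⟨y, hy, rfl⟩ := Finset.mem_image.1 hx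
    simpa using hy
  induction n with
  | zero => exact hx
  | succ n ih => rw [add_comm, zpow_one_add]; exact h _ ih
  | pred n ih => rw [sub_eq_neg_add, zpow_add, zpow_neg_one]; exact h' _ ih

variable {d : ℕ} (V : EuclideanSpace ℝ (Fin d) → ℝ) (α : ℝ) {θ : Site d → ℕ}

theorem kern_self (hV0 : V 0 = 0) (u : Points θ) : kern V α θ u u = 1 := by
  simp [kern, siteKernel, hV0]

theorem kern_le_one (hV : ∀ x, 0 ≤ V x) (hα : 0 ≤ α) (u v : Points θ) : kern V α θ u v ≤ 1 := by
  rw [kern, siteKernel, Real.toNNReal_le_one, Real.exp_le_one_iff, neg_mul, neg_nonpos]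
  exact mul_nonneg hα (hV _)

/-- The weight of the permutation `a` on `C`. -/
noncomputable def weight (C : Finset (Points θ)) (a : Equiv.Perm (Points θ)) : ℝ≥0 :=
  ∏ u ∈ C, kern V α θ u (a u)

theorem weight_le_one (hV : ∀ x, 0 ≤ V x) (hα : 0 ≤ α) (C : Finset (Points θ))
    (a : Equiv.Perm (Points θ)) : weight V α C a ≤ 1 :=
  Finset.prod_le_one' fun u _ => kern_le_one V α hV hα u (a u)

theorem specification_univ (hV0 : V 0 = 0) (Λ : Finset (Site d)) (ξ : Equiv.Perm (Points θ)) :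
    specification V α θ Λ ξ Set.univ = 1 := by
  have h1 := one_le_zPart (kern_self (θ := θ) V α hV0) (inner Λ ξ)
  rw [specification_apply V α Λ ξ MeasurableSet.univ]
  simp only [Set.mem_univ, Finset.filter_true]
  rw [sum_perms_comp _ fun u => apply_mem_inner.2, ENNReal.div_self _ ENNReal.coe_ne_top]
  exact ENNReal.coe_ne_zero.2 (zero_lt_one.trans_le h1).ne'

/-- The boundary condition acts only through the set `inner Λ ξ`: replacing `ξ` there by a
permutation `b` of this set and absorbing `b` in `τ` leaves the random permutation of `inner Λ ξ`
itself. -/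
theorem specification_cyl (hV0 : V 0 = 0) {Λ : Finset (Site d)} {ξ : Equiv.Perm (Points θ)}
    {C : Finset (Points θ)} (hC : C ⊆ inner Λ ξ) {a : Equiv.Perm (Points θ)}
    (ha : a ∈ permsOfFinset C) :
    specification V α θ Λ ξ (cyl C a) =
      ENNReal.ofReal (weight V α C a * avoidProb (kern V α θ) C (inner Λ ξ)) := by
  classical
  have h1 := one_le_zPart (kern_self (θ := θ) V α hV0) (inner Λ ξ)
  have h0 : zPart (kern V α θ) (inner Λ ξ) ≠ 0 := (zero_lt_one.trans_le h1).ne'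
  obtain ⟨b, hb, hbξ⟩ := exists_perms_eqOn (D := inner Λ ξ) (σ := ξ) fun u => apply_mem_inner.2
  have hsum : ∑ τ ∈ permsOfFinset (inner Λ ξ) with ξ * τ ∈ cyl C a,
      ∏ u ∈ inner Λ ξ, kern V α θ u (ξ (τ u)) =
      weight V α C a * zPart (kern V α θ) (inner Λ ξ \ C) := by
    rw [weight, ← sum_perms_eqOn _ hC ha]
    refine Finset.sum_bij' (fun τ _ => b * τ) (fun c _ => b⁻¹ * c) ?_ ?_ ?_ ?_ ?_
    · intro τ hτ
      rw [Finset.mem_filter] at *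
      refine ⟨perms_mul hb hτ.1, fun u hu => ?_⟩
      rw [← hτ.2 u hu, Equiv.Perm.mul_apply, Equiv.Perm.mul_apply,
        hbξ _ ((perms_apply_mem hτ.1).2 (hC hu))]
    · intro c hc
      rw [Finset.mem_filter] at *
      have hbc := perms_mul (perms_inv hb) hc.1
      refine ⟨hbc, fun u hu => ?_⟩
      rw [Equiv.Perm.mul_apply, ← hbξ _ ((perms_apply_mem hbc).2 (hC hu)), ← hc.2 u hu]
      simp
    · intro τ _; simp
    · intro c _; simp
    · intro τ hτ
      rw [Finset.mem_filter] at hτ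
      refine Finset.prod_congr rfl fun u hu => ?_
      rw [Equiv.Perm.mul_apply, hbξ _ ((perms_apply_mem hτ.1).2 hu)]
  rw [specification_apply V α Λ ξ (measurableSet_cyl C a), hsum, ← ENNReal.coe_div h0,
    avoidProb, ENNReal.ofReal, ENNReal.coe_inj, ← NNReal.coe_inj,
    Real.coe_toNNReal _ (by positivity)]
  push_cast
  ring

/-- The permutations for which `F` is contained in an invariant set over `Λ`. -/
def contained (F : Finset (Points θ)) (Λ : Finset (Site d)) : Set (Equiv.Perm (Points θ)) :=
  ⋃ C ∈ {C ∈ (box θ Λ).powerset | F ⊆ C}, ⋃ a ∈ permsOfFinset C, cyl C a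

theorem mem_contained {F : Finset (Points θ)} {Λ : Finset (Site d)} {ξ : Equiv.Perm (Points θ)} :
    ξ ∈ contained F Λ ↔ ∃ C, C ⊆ box θ Λ ∧ F ⊆ C ∧ ∀ x ∈ C, ξ x ∈ C := by
  simp only [contained, Set.mem_iUnion, Finset.mem_filter, Finset.mem_powerset, exists_prop]
  constructor
  · rintro ⟨C, ⟨h1, h2⟩, a, ha, h⟩
    exact ⟨C, h1, h2, fun x hx => by rw [h x hx]; exact (perms_apply_mem ha).2 hx⟩
  · rintro ⟨C, h1, h2, h⟩
    obtain ⟨b, hb, hbξ⟩ := exists_perms_eqOn h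
    exact ⟨C, ⟨h1, h2⟩, b, hb, fun u hu => (hbξ u hu).symm⟩

theorem isClopen_contained (F : Finset (Points θ)) (Λ : Finset (Site d)) :
    IsClopen (contained F Λ) :=
  isClopen_biUnion_finset fun C _ => isClopen_biUnion_finset fun a _ => isClopen_cyl C a

theorem subset_inner_of_mem_contained {F : Finset (Points θ)} {Λ : Finset (Site d)}
    {ξ : Equiv.Perm (Points θ)} (h : ξ ∈ contained F Λ) : F ⊆ inner Λ ξ := by
  obtain ⟨C, h1, h2, h3⟩ := mem_contained.1 h
  exact fun u hu => mem_inner.2 fun n => h1 (zpow_apply_mem_of_mapsTo h3 n (h2 hu))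

theorem monotone_contained (F : Finset (Points θ)) : Monotone (contained F) := by
  intro Λ Λ' h ξ hξ
  obtain ⟨C, h1, h2, h3⟩ := mem_contained.1 hξ
  exact mem_contained.2 ⟨C, fun u hu => mem_box.2 (h (mem_box.1 (h1 hu))), h2, h3⟩

theorem IsFiniteCycle.mem_contained {ξ : Equiv.Perm (Points θ)} (h : IsFiniteCycle ξ)
    (F : Finset (Points θ)) : ∃ Λ, ξ ∈ contained F Λ := by
  obtain ⟨C, h1, h2⟩ := h.exists_invariant F
  exact ⟨C.image Sigma.fst, SpatialPerm.mem_contained.2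
    ⟨C, fun u hu => mem_box.2 (Finset.mem_image_of_mem _ hu), h1, h2⟩⟩

/-- Continuity from above: the increasing events `contained F Λ` exhaust the finite cycle
permutations. -/
theorem exists_measure_compl_contained_le {μ : Measure (Equiv.Perm (Points θ))}
    [IsProbabilityMeasure μ] (hμ : ∀ᵐ σ ∂μ, IsFiniteCycle σ) (F : Finset (Points θ)) {ε : ℝ≥0∞}
    (hε : 0 < ε) : ∃ Λ, μ (contained F Λ)ᶜ ≤ ε := by
  have hlim := tendsto_measure_iInter_atTop (μ := μ) (s := fun Λ => (contained F Λ)ᶜ)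
    (fun Λ => (isClopen_contained F Λ).compl.isOpen.measurableSet.nullMeasurableSet)
    (fun Λ Λ' h => Set.compl_subset_compl.2 (monotone_contained F h)) ⟨∅, measure_ne_top _ _⟩
  have h0 : μ (⋂ Λ, (contained F Λ)ᶜ) = 0 := by
    refine measure_mono_null (t := {ξ | ¬ IsFiniteCycle ξ}) (fun ξ hξ hfc => ?_) (ae_iff.1 hμ)
    obtain ⟨Λ, hΛ⟩ := IsFiniteCycle.mem_contained hfc F
    exact Set.mem_iInter.1 hξ Λ hΛ
  rw [h0] at hlim
  exact (hlim.eventually (ge_mem_nhds hε)).exists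

/-- A finite cycle Gibbs measure gives the limiting probabilities to the cylinders. -/
theorem IsGibbs.measure_cyl (hV : ∀ x, 0 ≤ V x) (hV0 : V 0 = 0) (hα : 0 ≤ α)
    {μ : Measure (Equiv.Perm (Points θ))}
    (hG : IsGibbs V α θ μ) (hμ : ∀ᵐ σ ∂μ, IsFiniteCycle σ) {C : Finset (Points θ)} {κ : ℝ}
    (hκ : Filter.Tendsto (avoidProb (kern V α θ) C) Filter.atTop (nhds κ))
    {a : Equiv.Perm (Points θ)} (ha : a ∈ permsOfFinset C) :
    μ (cyl C a) = ENNReal.ofReal (weight V α C a * κ) := by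
  have := hG.1
  have hκ0 : 0 ≤ κ := ge_of_tendsto' hκ fun D => by unfold avoidProb; positivity
  have hwκ : ENNReal.ofReal (weight V α C a * κ) ≤ 1 := by
    rw [ENNReal.ofReal_le_one]
    have h1 : κ ≤ 1 := le_of_tendsto' hκ (avoidProb_le_one (kern_self V α hV0) C)
    exact mul_le_one₀ (by exact_mod_cast weight_le_one V α hV hα C a) hκ0 h1
  have hlim := hκ.const_mul (weight V α C a : ℝ)
  have key : ∀ ε : ℝ, 0 < ε →
      μ (cyl C a) ≤ ENNReal.ofReal (weight V α C a * κ) + ENNReal.ofReal ε ∧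
      ENNReal.ofReal (weight V α C a * κ) ≤ μ (cyl C a) + ENNReal.ofReal ε := by
    intro ε hε
    obtain ⟨F, hF⟩ := Filter.eventually_atTop.1 (Metric.tendsto_nhds.1 hlim (ε / 2) (half_pos hε))
    -- Off an event of mass at most `ε / 2`, `inner Λ ξ` contains `F ∪ C`, so the finite-volume
    -- ratio is already close to its limit.
    obtain ⟨Λ, hΛ⟩ := exists_measure_compl_contained_le hμ (F ∪ C)
      (ENNReal.ofReal_pos.2 (half_pos hε))
    have hbad : MeasurableSet (contained (F ∪ C) Λ)ᶜ :=
      (isClopen_contained _ Λ).compl.isOpen.measurableSet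
    have hgood : ∀ ξ ∈ contained (F ∪ C) Λ, |weight V α C a * avoidProb (kern V α θ) C (inner Λ ξ) -
        weight V α C a * κ| < ε / 2 ∧ specification V α θ Λ ξ (cyl C a) =
          ENNReal.ofReal (weight V α C a * avoidProb (kern V α θ) C (inner Λ ξ)) := by
      intro ξ hξ
      have hsub := subset_inner_of_mem_contained hξ
      exact ⟨hF _ (Finset.union_subset_left hsub),
        specification_cyl V α hV0 (Finset.union_subset_right hsub) ha⟩
    have hle1 : ∀ ξ, specification V α θ Λ ξ (cyl C a) ≤ 1 := fun ξ => by
      rw [← specification_univ V α hV0 Λ ξ]; exact measure_mono (Set.subset_univ _)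
    have hbound : ∀ c : ℝ≥0∞, ∫⁻ ξ, c + (contained (F ∪ C) Λ)ᶜ.indicator 1 ξ ∂μ ≤
        c + ENNReal.ofReal (ε / 2) := by
      intro c
      rw [lintegral_add_left measurable_const, lintegral_indicator_one hbad, lintegral_const,
        measure_univ, mul_one]
      gcongr
    have hhalf : ENNReal.ofReal ε = ENNReal.ofReal (ε / 2) + ENNReal.ofReal (ε / 2) := by
      rw [← ENNReal.ofReal_add (half_pos hε).le (half_pos hε).le, add_halves]
    rw [hG.2 Λ (cyl C a) (measurableSet_cyl C a)]
    constructor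
    · calc ∫⁻ ξ, specification V α θ Λ ξ (cyl C a) ∂μ
          ≤ ∫⁻ ξ, (ENNReal.ofReal (weight V α C a * κ) + ENNReal.ofReal (ε / 2)) +
              (contained (F ∪ C) Λ)ᶜ.indicator 1 ξ ∂μ := by
            refine lintegral_mono fun ξ => ?_
            by_cases hξ : ξ ∈ contained (F ∪ C) Λ
            · obtain ⟨h1, h2⟩ := hgood ξ hξ
              simp only
              rw [h2, ← ENNReal.ofReal_add (by positivity) (half_pos hε).le]
              refine le_add_right (ENNReal.ofReal_le_ofReal ?_)
              linarith [(abs_lt.1 h1).2]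
            · simp only
              rw [Set.indicator_of_mem (by exact hξ)]
              exact le_add_left (hle1 ξ)
        _ ≤ _ := by
            refine (hbound _).trans ?_
            rw [hhalf, add_assoc]
    · calc ENNReal.ofReal (weight V α C a * κ)
          = ∫⁻ _, ENNReal.ofReal (weight V α C a * κ) ∂μ := by simp
        _ ≤ ∫⁻ ξ, specification V α θ Λ ξ (cyl C a) +
              (ENNReal.ofReal (ε / 2) + (contained (F ∪ C) Λ)ᶜ.indicator 1 ξ) ∂μ := by
            refine lintegral_mono fun ξ => ?_
            by_cases hξ : ξ ∈ contained (F ∪ C) Λ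
            · obtain ⟨h1, h2⟩ := hgood ξ hξ
              simp only
              rw [h2, ← add_assoc, ← ENNReal.ofReal_add (by unfold avoidProb; positivity)
                (half_pos hε).le]
              refine le_add_right (ENNReal.ofReal_le_ofReal ?_)
              linarith [(abs_lt.1 h1).1]
            · simp only
              rw [Set.indicator_of_mem (by exact hξ)]
              exact le_add_left (le_add_left hwκ)
        _ ≤ _ := by
            -- Only the error term has to be measurable to split the integral; measurability of the
            -- specification in `ξ` is not established here.
            have hm : Measurable fun ξ =>
                ENNReal.ofReal (ε / 2) + (contained (F ∪ C) Λ)ᶜ.indicator 1 ξ :=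
              Measurable.const_add (measurable_one.indicator hbad) _
            rw [lintegral_add_right _ hm]
            gcongr
            refine (hbound _).trans ?_
            rw [hhalf]
  refine le_antisymm ?_ ?_
  · refine ENNReal.le_of_forall_pos_le_add fun ε hε _ => ?_
    simpa using (key ε hε).1
  · refine ENNReal.le_of_forall_pos_le_add fun ε hε _ => ?_
    simpa using (key ε hε).2

end Uniqueness

/-! ### Finite cycles as lists. -/

section CycleLists

variable {ι : Type*}

/-- `l` lists the cycle of `σ` through `s`, starting after `s`. -/
def ListsCycle (σ : Equiv.Perm ι) (s : ι) (l : List ι) : Prop :=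
  List.IsChain (fun u v => σ u = v) (s :: l) ∧ σ ((s :: l).getLast (by simp)) = s

theorem isChain_apply_mem {σ : Equiv.Perm ι} (s : ι) (l : List ι)
    (h : List.IsChain (fun u v => σ u = v) (s :: l)) {u : ι} (hu : u ∈ s :: l) :
    σ u ∈ l ∨ σ u = σ ((s :: l).getLast (by simp)) := by
  induction l generalizing s with
  | nil => right; simp at hu; simp [hu]
  | cons b l ih =>
    rw [List.isChain_cons_cons] at h
    rcases List.mem_cons.1 hu with rfl | hu
    · left; rw [h.1]; simp
    · rw [List.getLast_cons_cons]
      exact (ih b h.2 hu).imp (List.mem_cons_of_mem _) id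

theorem isChain_apply_eq {σ τ : Equiv.Perm ι} (s : ι) (l : List ι)
    (h : List.IsChain (fun u v => σ u = v) (s :: l))
    (h' : List.IsChain (fun u v => τ u = v) (s :: l))
    (hlast : σ ((s :: l).getLast (by simp)) = τ ((s :: l).getLast (by simp)))
    {u : ι} (hu : u ∈ s :: l) : σ u = τ u := by
  induction l generalizing s with
  | nil => simp at hu; simpa [hu] using hlast
  | cons b l ih =>
    rw [List.isChain_cons_cons] at h h'
    rcases List.mem_cons.1 hu with rfl | hu
    · rw [h.1, h'.1]
    · exact ih b h.2 h'.2 (by simpa using hlast) hu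

/-- The jump from the last point, which closes the cycle in the application, has weight at most one
and is dropped. -/
theorem isChain_prod_le {K : ι → ι → ℝ≥0} (hK : ∀ u v, K u v ≤ 1) {σ : Equiv.Perm ι} (s : ι)
    (l : List ι) (h : List.IsChain (fun u v => σ u = v) (s :: l)) :
    ((s :: l).map fun u => K u (σ u)).prod ≤ pathWeight K (s :: l) := by
  induction l generalizing s with
  | nil => simpa [pathWeight] using hK s (σ s)
  | cons b l ih =>
    rw [List.isChain_cons_cons] at h
    rw [List.map_cons, List.prod_cons, pathWeight, h.1]
    exact mul_le_mul_right (ih b h.2) _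

theorem ListsCycle.apply_mem {σ : Equiv.Perm ι} {s : ι} {l : List ι} (h : ListsCycle σ s l)
    {u : ι} (hu : u ∈ s :: l) : σ u ∈ s :: l := by
  rcases isChain_apply_mem s l h.1 hu with h1 | h1
  · exact List.mem_cons_of_mem _ h1
  · rw [h1, h.2]; simp

theorem isChain_iterate (σ : Equiv.Perm ι) (s : ι) (n : ℕ) :
    List.IsChain (fun u v => σ u = v) (List.iterate σ s n) := by
  induction n generalizing s with
  | zero => simp
  | succ n ih =>
    have := ih (σ s)
    cases n with
    | zero => simp
    | succ n =>
      simp only [List.iterate] at *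
      exact List.isChain_cons_cons.2 ⟨rfl, this⟩

theorem isChain_mem {σ : Equiv.Perm ι} {D : Set ι} (hD : ∀ x ∈ D, σ x ∈ D) (s : ι) (hs : s ∈ D)
    (l : List ι) (h : List.IsChain (fun u v => σ u = v) (s :: l)) {u : ι} (hu : u ∈ s :: l) :
    u ∈ D := by
  induction l generalizing s with
  | nil => simp at hu; rwa [hu]
  | cons b l ih =>
    rw [List.isChain_cons_cons] at h
    rcases List.mem_cons.1 hu with rfl | hu
    · exact hs
    · exact ih b (h.1 ▸ hD s hs) h.2 hu

theorem exists_pow_apply_eq_of_mapsTo {σ : Equiv.Perm ι} {D : Finset ι} (hD : ∀ x ∈ D, σ x ∈ D)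
    {s : ι} (hs : s ∈ D) : ∃ n, 0 < n ∧ (σ ^ n) s = s := by
  have hmem : ∀ n : ℕ, (σ ^ n) s ∈ D := by
    intro n
    induction n with
    | zero => exact hs
    | succ n ih => rw [pow_succ', Equiv.Perm.mul_apply]; exact hD _ ih
  obtain ⟨i, j, hij, h⟩ := Finite.exists_ne_map_eq_of_infinite fun n : ℕ => (⟨_, hmem n⟩ : D)
  have h' : (σ ^ i) s = (σ ^ j) s := congrArg Subtype.val h
  have key : ∀ i j : ℕ, i < j → (σ ^ i) s = (σ ^ j) s → ∃ n, 0 < n ∧ (σ ^ n) s = s := by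
    intro i j hij h
    refine ⟨j - i, Nat.sub_pos_of_lt hij, (σ ^ i).injective ?_⟩
    rw [← Equiv.Perm.mul_apply, ← pow_add, Nat.add_sub_cancel' hij.le, h]
  rcases lt_or_gt_of_ne hij with hlt | hlt
  · exact key i j hlt h'
  · exact key j i hlt h'.symm

theorem exists_listsCycle {σ : Equiv.Perm ι} {s : ι} {n : ℕ} (hn : 0 < n) (h : (σ ^ n) s = s) :
    ∃ l, (s :: l).Nodup ∧ ListsCycle σ s l := by
  have hper : s ∈ Function.periodicPts σ := ⟨n, hn, by
    rw [Function.IsPeriodicPt, Function.IsFixedPt, ← Equiv.Perm.coe_pow]; exact h⟩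
  obtain ⟨m, hm⟩ := Nat.exists_eq_succ_of_ne_zero
    (Function.minimalPeriod_pos_of_mem_periodicPts hper).ne'
  refine ⟨List.iterate σ (σ s) m, ?_, ?_, ?_⟩
  · change (List.iterate σ s (m + 1)).Nodup
    rw [← List.range_map_iterate]
    refine List.Nodup.map_on ?_ List.nodup_range
    intro x hx y hy hxy
    rw [List.mem_range] at hx hy
    refine Function.iterate_injOn_Iio_minimalPeriod (f := σ) (x := s) ?_ ?_ hxy
    · rw [hm]; exact hx
    · rw [hm]; exact hy
  · exact isChain_iterate σ s (m + 1)
  · have h1 : ∀ (t : ι) (k : ℕ), σ ((t :: List.iterate σ (σ t) k).getLast (by simp)) =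
        σ^[k + 1] t := by
      intro t k
      induction k generalizing t with
      | zero => simp
      | succ k ih =>
        simp only [List.iterate] at *
        rw [List.getLast_cons_cons, ih, ← Function.iterate_succ_apply]
    rw [h1]
    have := Function.isPeriodicPt_minimalPeriod σ s
    rwa [hm] at this

end CycleLists

/-! ### Tightness and limit points with identity boundary condition. -/

section Existence

variable {d : ℕ} (V : EuclideanSpace ℝ (Fin d) → ℝ) (α : ℝ) {θ : Site d → ℕ}

theorem inner_one (Λ : Finset (Site d)) : inner Λ (1 : Equiv.Perm (Points θ)) = box θ Λ := by
  ext u; simp [mem_inner]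

/-- Permutations with the same listed cycle agree on it, so they lie in one cylinder, whose
probability is at most the weight of the cycle. -/
theorem specification_one_cycle_le (hV : ∀ x, 0 ≤ V x) (hV0 : V 0 = 0) (hα : 0 ≤ α)
    (Λ : Finset (Site d)) {s : Points θ} {l : List (Points θ)} (hl : (s :: l).Nodup)
    (hlΛ : ∀ u ∈ s :: l, u ∈ box θ Λ) :
    specification V α θ Λ 1 {σ | ListsCycle σ s l} ≤ pathWeight (kern V α θ) (s :: l) := by
  rcases Set.eq_empty_or_nonempty {σ | ListsCycle σ s l} with h | ⟨σ, hσ⟩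
  · rw [h, measure_empty]; exact zero_le
  have hσ' : ListsCycle σ s l := hσ
  have hinv : ∀ x ∈ (s :: l).toFinset, σ x ∈ (s :: l).toFinset := fun x hx => by
    rw [List.mem_toFinset] at *; exact hσ'.apply_mem hx
  obtain ⟨a, ha, haσ⟩ := exists_perms_eqOn hinv
  have hsub : {σ | ListsCycle σ s l} ⊆ cyl (s :: l).toFinset a := by
    intro τ hτ u hu
    have hτ' : ListsCycle τ s l := hτ
    rw [haσ u hu]
    exact isChain_apply_eq s l hτ'.1 hσ'.1 (hτ'.2.trans hσ'.2.symm) (List.mem_toFinset.1 hu)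
  refine (measure_mono hsub).trans ?_
  rw [specification_cyl V α hV0
    (by rw [inner_one]; exact fun u hu => hlΛ u (List.mem_toFinset.1 hu)) ha, ← ENNReal.ofReal_coe_nnreal]
  refine ENNReal.ofReal_le_ofReal ?_
  refine (mul_le_of_le_one_right (by positivity)
    (avoidProb_le_one (kern_self V α hV0) _ _)).trans ?_
  rw [NNReal.coe_le_coe, weight, Finset.prod_congr rfl fun u hu => by rw [haσ u hu],
    List.prod_toFinset _ hl]
  exact isChain_prod_le (kern_le_one V α hV hα) s l hσ'.1

theorem specification_one_compl_perms (Λ : Finset (Site d)) :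
    specification V α θ Λ 1 (permsOfFinset (box θ Λ) : Set (Equiv.Perm (Points θ)))ᶜ = 0 := by
  rw [specification_apply V α Λ 1 (Finset.measurableSet _).compl, Finset.sum_filter,
    Finset.sum_eq_zero]
  · simp
  · intro τ hτ
    rw [inner_one] at hτ
    rw [if_neg]
    simpa using hτ

/-- The cycle of a given point is tight, uniformly in the volume. -/
theorem exists_specification_compl_contained_le (hV : ∀ x, 0 ≤ V x) (hV0 : V 0 = 0) (hα : 0 ≤ α)
    {s : Points θ} (hs : pathTotal (kern V α θ) s < ∞) {ε : ℝ≥0∞} (hε : 0 < ε) :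
    ∃ Λ', ∀ Λ, specification V α θ Λ 1 (contained {s} Λ')ᶜ ≤ ε := by
  classical
  -- All but `ε` of the path weight from `s` is carried by the finite family `T`. The region below
  -- covers `T`, so a cycle that is not contained in it is listed outside `T`.
  obtain ⟨T, hT⟩ := ((ENNReal.tendsto_tsum_compl_atTop_zero hs.ne).eventually
    (ge_mem_nhds hε)).exists
  refine ⟨insert s.1 (T.biUnion fun l => (l.map Sigma.fst).toFinset), fun Λ => ?_⟩
  set Λ' := insert s.1 (T.biUnion fun l => (l.map Sigma.fst).toFinset) with hΛ'
  have hsΛ' : s ∈ box θ Λ' := mem_box.2 (Finset.mem_insert_self _ _)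
  let Q : Set (List (Points θ)) := {l | (s :: l).Nodup ∧ (∀ u ∈ s :: l, u ∈ box θ Λ) ∧ l ∉ T}
  have hcover : (contained {s} Λ')ᶜ ∩ (permsOfFinset (box θ Λ) : Set (Equiv.Perm (Points θ))) ⊆
      ⋃ l : Q, {σ | ListsCycle σ s l.1} := by
    rintro σ ⟨h1, h2⟩
    have h2' : σ ∈ permsOfFinset (box θ Λ) := h2
    have hsΛ : s ∈ box θ Λ := by
      by_contra hs'
      refine h1 (mem_contained.2 ⟨{s}, by simpa using hsΛ', subset_rfl, fun x hx => ?_⟩)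
      rw [Finset.mem_singleton] at *
      rw [hx, mem_perms_iff.1 h2' s hs']
    have hinv : ∀ x ∈ box θ Λ, σ x ∈ box θ Λ := fun x => (perms_apply_mem h2').2
    obtain ⟨n, hn0, hn⟩ := exists_pow_apply_eq_of_mapsTo hinv hsΛ
    obtain ⟨l, hl, hlc⟩ := exists_listsCycle hn0 hn
    refine Set.mem_iUnion.2 ⟨⟨l, hl, fun u hu => ?_, ?_⟩, hlc⟩
    · exact isChain_mem (D := box θ Λ) hinv s hsΛ l hlc.1 hu
    · intro hlT
      refine h1 (mem_contained.2 ⟨(s :: l).toFinset, fun u hu => ?_, by simp, fun x hx => ?_⟩)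
      · rw [List.mem_toFinset] at hu
        rcases List.mem_cons.1 hu with rfl | hu
        · exact hsΛ'
        · refine mem_box.2 (Finset.mem_insert_of_mem (Finset.mem_biUnion.2 ⟨l, hlT, ?_⟩))
          rw [List.mem_toFinset]
          exact List.mem_map_of_mem hu
      · rw [List.mem_toFinset] at *
        exact hlc.apply_mem hx
  calc specification V α θ Λ 1 (contained {s} Λ')ᶜ
      ≤ specification V α θ Λ 1 (((contained {s} Λ')ᶜ ∩
          (permsOfFinset (box θ Λ) : Set (Equiv.Perm (Points θ)))) ∪
          (permsOfFinset (box θ Λ) : Set (Equiv.Perm (Points θ)))ᶜ) := by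
        refine measure_mono fun σ hσ => ?_
        by_cases h : σ ∈ (permsOfFinset (box θ Λ) : Set (Equiv.Perm (Points θ)))
        · exact Or.inl ⟨hσ, h⟩
        · exact Or.inr h
    _ ≤ specification V α θ Λ 1 ((contained {s} Λ')ᶜ ∩
          (permsOfFinset (box θ Λ) : Set (Equiv.Perm (Points θ)))) + 0 := by
        rw [← specification_one_compl_perms V α (θ := θ) Λ]
        exact measure_union_le _ _
    _ ≤ ∑' l : Q, specification V α θ Λ 1 {σ | ListsCycle σ s l.1} := by
        rw [add_zero]
        exact (measure_mono hcover).trans (measure_iUnion_le _)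
    _ ≤ ∑' l : Q, {l | (s :: l).Nodup}.indicator
          (fun l => (pathWeight (kern V α θ) (s :: l) : ℝ≥0∞)) l.1 := by
        refine ENNReal.tsum_le_tsum fun l => ?_
        rw [Set.indicator_of_mem (by exact l.2.1)]
        exact specification_one_cycle_le V α hV hV0 hα Λ l.2.1 l.2.2.1
    _ ≤ ∑' l : {l // l ∉ T}, {l | (s :: l).Nodup}.indicator
          (fun l => (pathWeight (kern V α θ) (s :: l) : ℝ≥0∞)) l.1 := by
        let f : Q → {l // l ∉ T} := fun l => ⟨l.1, l.2.2.2⟩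
        have hf : Function.Injective f := fun a b h => Subtype.ext (by simpa [f] using h)
        exact ENNReal.tsum_comp_le_tsum_of_injective hf
          (fun l : {l // l ∉ T} => {l | (s :: l).Nodup}.indicator
          (fun l => (pathWeight (kern V α θ) (s :: l) : ℝ≥0∞)) l.1)
    _ ≤ ε := hT

theorem tendsto_measure_of_isClopen {Ω ι : Type*} [MeasurableSpace Ω] [TopologicalSpace Ω]
    [OpensMeasurableSpace Ω] {L : Filter ι} {P : ι → ProbabilityMeasure Ω}
    {μ : ProbabilityMeasure Ω} (h : Filter.Tendsto P L (nhds μ)) {A : Set Ω} (hA : IsClopen A) :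
    Filter.Tendsto (fun i => (P i : Measure Ω) A) L (nhds ((μ : Measure Ω) A)) := by
  have h1 := ProbabilityMeasure.tendsto_iff_forall_integral_tendsto.1 h
    (BoundedContinuousFunction.indicator A hA)
  simp only [BoundedContinuousFunction.indicator_apply,
    integral_indicator_one hA.isOpen.measurableSet] at h1
  have h2 := ENNReal.tendsto_ofReal h1
  simpa [ofReal_measureReal] using h2

theorem tendsto_box_atTop : Filter.Tendsto (box θ) Filter.atTop Filter.atTop := by
  refine Filter.tendsto_atTop.2 fun C => ?_
  filter_upwards [Filter.eventually_ge_atTop (C.image Sigma.fst)] with Λ hΛ u hu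
  exact mem_box.2 (hΛ (Finset.mem_image_of_mem _ hu))

/-- Existence of a finite cycle measure with the limiting cylinder probabilities. -/
theorem exists_measure_cyl (hV : ∀ x, 0 ≤ V x) (hV0 : V 0 = 0) (hα : 0 ≤ α)
    (hpath : ∀ s, pathTotal (kern V α θ) s < ∞) {κ : Finset (Points θ) → ℝ}
    (hκ : ∀ C, Filter.Tendsto (avoidProb (kern V α θ) C) Filter.atTop (nhds (κ C))) :
    ∃ μ : Measure (Equiv.Perm (Points θ)), IsProbabilityMeasure μ ∧
      (∀ᵐ σ ∂μ, IsFiniteCycle σ) ∧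
      ∀ C, ∀ a ∈ permsOfFinset C, μ (cyl C a) = ENNReal.ofReal (weight V α C a * κ C) := by
  let P : Finset (Site d) → ProbabilityMeasure (Equiv.Perm (Points θ)) := fun Λ =>
    ⟨specification V α θ Λ 1, ⟨specification_univ V α hV0 Λ 1⟩⟩
  have htight : IsTightMeasureSet {((μ : ProbabilityMeasure (Equiv.Perm (Points θ))) :
      Measure (Equiv.Perm (Points θ))) | μ ∈ Set.range P} := by
    rw [isTightMeasureSet_iff_exists_isCompact_measure_compl_le]
    intro ε hε
    -- The error is distributed over the countably many points, each with its own region for the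
    -- image and the preimage.
    obtain ⟨δ, hδ0, hδ⟩ := ENNReal.exists_pos_sum_of_countable hε.ne' (Points θ)
    choose Λ' hΛ' using fun s => exists_specification_compl_contained_le V α hV hV0 hα (hpath s)
      (ENNReal.coe_pos.2 (hδ0 s))
    refine ⟨_, isCompact_perm_of_finite fun s => box θ (Λ' s), ?_⟩
    rintro _ ⟨_, ⟨Λ, rfl⟩, rfl⟩
    refine le_trans ?_ hδ.le
    refine le_trans (measure_mono ?_) ((measure_iUnion_le fun s => (contained {s} (Λ' s))ᶜ).trans
      (ENNReal.tsum_le_tsum fun s => hΛ' s Λ))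
    intro σ hσ
    by_contra hcon
    simp only [Set.mem_iUnion, Set.mem_compl_iff, not_exists, not_not] at hcon
    refine hσ fun s => ?_
    have hs := mem_inner.1 (subset_inner_of_mem_contained (hcon s) (Finset.mem_singleton_self s))
    refine ⟨by simpa using hs 1, ?_⟩
    rw [← zpow_neg_one]; exact hs (-1)
  have hcomp := isCompact_closure_of_isTightMeasureSet htight
  let U : Ultrafilter (Finset (Site d)) := Ultrafilter.of Filter.atTop
  have hU : (U : Filter (Finset (Site d))) ≤ Filter.atTop := Ultrafilter.of_le _
  obtain ⟨μ, -, hμ⟩ := isCompact_iff_ultrafilter_le_nhds.1 hcomp (U.map P) (by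
    rw [Filter.le_principal_iff]
    exact Ultrafilter.mem_map.2 (Filter.univ_mem' fun Λ => subset_closure ⟨Λ, rfl⟩))
  have hlim : Filter.Tendsto P U (nhds μ) := hμ
  refine ⟨μ, inferInstance, ?_, ?_⟩
  · have hs : ∀ s, ∀ᵐ σ ∂(μ : Measure (Equiv.Perm (Points θ))), ∃ n : ℕ, 0 < n ∧ (σ ^ n) s = s := by
      intro s
      rw [ae_iff]
      refine le_antisymm (le_of_forall_pos_le_add fun ε hε => ?_) zero_le
      rw [zero_add]
      obtain ⟨Λ', hΛ'⟩ := exists_specification_compl_contained_le V α hV hV0 hα (hpath s) hε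
      -- The bound, uniform in the volume, passes to the limit because the event is clopen.
      have h1 := le_of_tendsto (tendsto_measure_of_isClopen hlim
        (isClopen_contained {s} Λ').compl) (Filter.Eventually.of_forall hΛ')
      refine le_trans (measure_mono ?_) h1
      intro σ hσ hcon
      refine hσ ?_
      obtain ⟨C, -, hsC, hC⟩ := mem_contained.1 hcon
      exact exists_pow_apply_eq_of_mapsTo hC (hsC (Finset.mem_singleton_self s))
    exact ae_all_iff.2 hs
  · intro C a ha
    refine tendsto_nhds_unique (tendsto_measure_of_isClopen hlim (isClopen_cyl C a)) ?_
    have h1 : Filter.Tendsto (fun Λ => ENNReal.ofReal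
        (weight V α C a * avoidProb (kern V α θ) C (box θ Λ))) U
        (nhds (ENNReal.ofReal (weight V α C a * κ C))) :=
      ENNReal.tendsto_ofReal (((hκ C).comp (tendsto_box_atTop.mono_left hU)).const_mul _)
    refine h1.congr' ?_
    filter_upwards [hU (tendsto_box_atTop (Filter.eventually_ge_atTop C))] with Λ hΛ
    have := specification_cyl V α hV0 (Λ := Λ) (ξ := 1) (by rw [inner_one]; exact hΛ) ha
    rw [inner_one] at this
    exact this.symm

end Existence

/-! ### The Gibbs equations for the limiting cylinder probabilities. -/

section Gibbs

variable {d : ℕ} (V : EuclideanSpace ℝ (Fin d) → ℝ) (α : ℝ) {θ : Site d → ℕ}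

theorem zpow_apply_eq_of_mem_cyl {C : Finset (Points θ)} {a σ : Equiv.Perm (Points θ)}
    (ha : a ∈ permsOfFinset C) (hσ : σ ∈ cyl C a) (n : ℤ) {u : Points θ} (hu : u ∈ C) :
    (σ ^ n) u = (a ^ n) u := by
  have ha' : ∀ x ∈ C, a x ∈ C := fun x => (perms_apply_mem ha).2
  induction n with
  | zero => rfl
  | succ n ih =>
    rw [add_comm, zpow_one_add, zpow_one_add, Equiv.Perm.mul_apply, Equiv.Perm.mul_apply, ih]
    exact hσ _ (zpow_apply_mem_of_mapsTo ha' _ hu)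
  | pred n ih =>
    rw [sub_eq_neg_add, zpow_add, zpow_add, Equiv.Perm.mul_apply, Equiv.Perm.mul_apply, ih,
      zpow_neg_one, zpow_neg_one, Equiv.Perm.inv_eq_iff_eq]
    have hx : a⁻¹ ((a ^ (-(n : ℤ))) u) ∈ C := by
      have := zpow_apply_mem_of_mapsTo ha' (-1 + -(n : ℤ)) hu
      rwa [zpow_add, zpow_neg_one, Equiv.Perm.mul_apply] at this
    rw [hσ _ hx]
    simp

theorem inner_eq_of_mem_cyl {Λ : Finset (Site d)} {C : Finset (Points θ)} (hC : box θ Λ ⊆ C)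
    {a σ : Equiv.Perm (Points θ)} (ha : a ∈ permsOfFinset C) (hσ : σ ∈ cyl C a) :
    inner Λ σ = inner Λ a := by
  ext u
  by_cases hu : u ∈ C
  · simp only [mem_inner, zpow_apply_eq_of_mem_cyl ha hσ _ hu]
  · exact iff_of_false (fun h => hu (hC (inner_subset _ _ h)))
      fun h => hu (hC (inner_subset _ _ h))

/-- The specification of a cylinder over an invariant set that contains all points over `Λ`. -/
theorem specification_cyl_of_box_subset {Λ : Finset (Site d)} {C : Finset (Points θ)}
    (hC : box θ Λ ⊆ C) {a : Equiv.Perm (Points θ)} (ha : a ∈ permsOfFinset C)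
    (ξ : Equiv.Perm (Points θ)) :
    specification V α θ Λ ξ (cyl C a) =
      ∑ c ∈ permsOfFinset (inner Λ a), (cyl C (a * c)).indicator
        (fun _ => (weight V α (inner Λ a) a : ℝ≥0∞) / zPart (kern V α θ) (inner Λ a)) ξ := by
  have hIC : inner Λ a ⊆ C := (inner_subset Λ a).trans hC
  -- The cylinder is reachable from `ξ` only if `ξ` agrees on `C` with some `a * c`; then `c` is
  -- unique and `τ = c⁻¹` is the only resampling that contributes.
  by_cases hex : ∃ c ∈ permsOfFinset (inner Λ a), ξ ∈ cyl C (a * c)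
  · obtain ⟨c, hc, hξ⟩ := hex
    have hcC := perms_mono hIC hc
    have hinner : inner Λ ξ = inner Λ a := by
      rw [inner_eq_of_mem_cyl hC (perms_mul ha hcC) hξ]
      exact inner_eq_of_compatible (mem_compatible_iff.2 (by simpa using hc))
    rw [Finset.sum_eq_single c, Set.indicator_of_mem hξ, specification_apply V α Λ ξ
      (measurableSet_cyl C a), hinner, Finset.sum_filter, Finset.sum_eq_single c⁻¹, if_pos]
    · congr 2
      refine Finset.prod_congr rfl fun u hu => ?_
      rw [hξ _ ((perms_apply_mem (perms_inv hcC)).2 (hIC hu))]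
      simp
    · intro u hu
      rw [Equiv.Perm.mul_apply, hξ _ ((perms_apply_mem (perms_inv hcC)).2 hu)]
      simp
    · intro τ hτ hne
      rw [if_neg]
      intro h
      refine hne (eq_inv_of_mul_eq_one_right (Equiv.ext fun u => ?_))
      by_cases hu : u ∈ C
      · have h1 := h u hu
        rw [Equiv.Perm.mul_apply, hξ _ ((perms_apply_mem (perms_mono hIC hτ)).2 hu)] at h1
        exact a.injective h1
      · rw [Equiv.Perm.mul_apply, mem_perms_iff.1 (perms_mono hIC hτ) u hu,
          mem_perms_iff.1 hcC u hu, Equiv.Perm.one_apply]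
    · intro h; exact absurd (perms_inv hc) h
    · intro c' hc' hne
      refine Set.indicator_of_notMem (fun h => hne (Equiv.ext fun u => ?_)) _
      by_cases hu : u ∈ C
      · exact a.injective ((h u hu).symm.trans (hξ u hu))
      · rw [mem_perms_iff.1 hcC u hu, mem_perms_iff.1 (perms_mono hIC hc') u hu]
    · intro h; exact absurd hc h
  · push Not at hex
    rw [Finset.sum_eq_zero fun c hc => Set.indicator_of_notMem (hex c hc) _,
      specification_apply V α Λ ξ (measurableSet_cyl C a), Finset.sum_filter, Finset.sum_eq_zero]
    · simp
    · intro τ hτ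
      rw [if_neg]
      intro h
      have hinner : inner Λ ξ = inner Λ a := by
        rw [← inner_eq_of_mem_cyl hC ha h]
        exact (inner_eq_of_compatible (mem_compatible_iff.2 (by simpa using hτ))).symm
      rw [hinner] at hτ
      refine hex τ⁻¹ (perms_inv hτ) fun u hu => ?_
      have := h _ ((perms_apply_mem (perms_mono hIC (perms_inv hτ))).2 hu)
      simpa using this

/-- All cylinders involved are over the same `C` and share the factor `κ C`. Summing the weights of
`a * c` over `c` produces `zPart` of the inner set, which cancels the denominator. -/
theorem lintegral_specification_cyl (hV0 : V 0 = 0) {μ : Measure (Equiv.Perm (Points θ))}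
    {κ : Finset (Points θ) → ℝ}
    (hμ : ∀ C, ∀ a ∈ permsOfFinset C, μ (cyl C a) = ENNReal.ofReal (weight V α C a * κ C))
    {Λ : Finset (Site d)} {C : Finset (Points θ)} (hC : box θ Λ ⊆ C) {a : Equiv.Perm (Points θ)}
    (ha : a ∈ permsOfFinset C) :
    ∫⁻ ξ, specification V α θ Λ ξ (cyl C a) ∂μ = μ (cyl C a) := by
  have hIC : inner Λ a ⊆ C := (inner_subset Λ a).trans hC
  have h1 := one_le_zPart (kern_self (θ := θ) V α hV0) (inner Λ a)
  have h0 : zPart (kern V α θ) (inner Λ a) ≠ 0 := (zero_lt_one.trans_le h1).ne'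
  simp only [specification_cyl_of_box_subset V α hC ha]
  rw [lintegral_finsetSum _ fun c _ => measurable_const.indicator (measurableSet_cyl C (a * c))]
  simp only [lintegral_indicator_const (measurableSet_cyl C _)]
  have hμ' : ∀ C, ∀ a ∈ permsOfFinset C,
      μ (cyl C a) = ((weight V α C a * (κ C).toNNReal : ℝ≥0) : ℝ≥0∞) := by
    intro C a ha
    rw [hμ C a ha, ENNReal.ofReal_mul (by positivity), ENNReal.ofReal_coe_nnreal, ENNReal.coe_mul]
    rfl
  have hw : ∀ c ∈ permsOfFinset (inner Λ a), weight V α C (a * c) =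
      (∏ u ∈ C \ inner Λ a, kern V α θ u (a u)) *
        ∏ u ∈ inner Λ a, kern V α θ u (a (c u)) := by
    intro c hc
    rw [weight, ← Finset.prod_sdiff hIC]
    congr 1
    refine Finset.prod_congr rfl fun u hu => ?_
    rw [Equiv.Perm.mul_apply, mem_perms_iff.1 hc u (Finset.mem_sdiff.1 hu).2]
  have hsum : ∑ c ∈ permsOfFinset (inner Λ a), weight V α C (a * c) =
      (∏ u ∈ C \ inner Λ a, kern V α θ u (a u)) * zPart (kern V α θ) (inner Λ a) := by
    rw [Finset.sum_congr rfl hw, ← Finset.mul_sum,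
      sum_perms_comp _ fun u => apply_mem_inner.2]
  rw [← Finset.mul_sum, Finset.sum_congr rfl fun c hc => hμ' C (a * c)
    (perms_mul ha (perms_mono hIC hc)), hμ' C a ha, ← ENNReal.coe_div h0,
    ← ENNReal.ofNNReal_finsetSum, ← ENNReal.coe_mul, ENNReal.coe_inj, ← Finset.sum_mul, hsum]
  have hwC : weight V α C a = (∏ u ∈ C \ inner Λ a, kern V α θ u (a u)) *
      weight V α (inner Λ a) a := (Finset.prod_sdiff hIC).symm
  rw [hwC]
  field_simp

/-- Resampling preserves finite cycles: inner points form a finite invariant set, and all other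
points keep their orbit under `ξ`. -/
theorem IsFiniteCycle.of_compatible {Λ : Finset (Site d)} {ξ σ : Equiv.Perm (Points θ)}
    (hξ : IsFiniteCycle ξ) (h : σ ∈ compatible θ Λ ξ) : IsFiniteCycle σ := by
  intro s
  by_cases hs : s ∈ inner Λ ξ
  · rw [← inner_eq_of_compatible h] at hs
    exact exists_pow_apply_eq_of_mapsTo (fun x => apply_mem_inner.2) hs
  · rw [mem_inner, not_forall] at hs
    obtain ⟨n, hn⟩ := hs
    have hv := h ((ξ ^ n) s) fun hΛ => hn (mem_box.2 hΛ)
    obtain ⟨m, hm0, hm⟩ := hξ ((ξ ^ n) s)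
    refine ⟨m, hm0, ?_⟩
    have h1 : (σ ^ (-n)) ((ξ ^ n) s) = s := by
      rw [hv, ← Equiv.Perm.mul_apply, ← zpow_add, neg_add_cancel, zpow_zero, Equiv.Perm.one_apply]
    have h2 : (σ ^ m) ((ξ ^ n) s) = (ξ ^ n) s := by
      have := hv m
      rw [zpow_natCast, zpow_natCast] at this
      rw [this, hm]
    rw [← h1, ← Equiv.Perm.mul_apply, ← zpow_natCast, ← zpow_add, add_comm, zpow_add,
      Equiv.Perm.mul_apply, zpow_natCast, h2]

theorem specification_congr {Λ : Finset (Site d)} {ξ : Equiv.Perm (Points θ)}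
    (hξ : IsFiniteCycle ξ) {A B : Set (Equiv.Perm (Points θ))} (hA : MeasurableSet A)
    (hB : MeasurableSet B) (hAB : ∀ σ, IsFiniteCycle σ → (σ ∈ A ↔ σ ∈ B)) :
    specification V α θ Λ ξ A = specification V α θ Λ ξ B := by
  classical
  rw [specification_apply V α Λ ξ hA, specification_apply V α Λ ξ hB]
  congr 3
  refine Finset.filter_congr fun τ hτ => hAB _ (hξ.of_compatible (Λ := Λ) (mem_compatible_iff.2 ?_))
  simpa using hτ

/-- A finite cycle measure with the limiting cylinder probabilities is a Gibbs measure. -/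
theorem isGibbs_of_measure_cyl (hV0 : V 0 = 0) {μ : Measure (Equiv.Perm (Points θ))}
    [IsProbabilityMeasure μ] (hfc : ∀ᵐ σ ∂μ, IsFiniteCycle σ)
    {κ : Finset (Points θ) → ℝ}
    (hμ : ∀ C, ∀ a ∈ permsOfFinset C, μ (cyl C a) = ENNReal.ofReal (weight V α C a * κ C)) :
    IsGibbs V α θ μ := by
  refine ⟨inferInstance, fun Λ A hA => ?_⟩
  -- The sets underlying the cylinders must contain `box θ Λ` for the explicit formula for the
  -- specification to apply.
  obtain ⟨B, hB, hAB⟩ := exists_generateFrom_cylinders (box θ Λ) hA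
  have hBm := generateFrom_cylinders_le _ B hB
  have h1 : μ A = μ B := measure_congr (hfc.mono fun σ hσ => propext (hAB σ hσ))
  have h2 : ∫⁻ ξ, specification V α θ Λ ξ A ∂μ = ∫⁻ ξ, specification V α θ Λ ξ B ∂μ :=
    lintegral_congr_ae (hfc.mono fun ξ hξ => specification_congr V α hξ hA hBm hAB)
  rw [h1, h2]
  clear h1 h2 hAB hBm
  have hprob : ∀ ξ, IsProbabilityMeasure (specification V α θ Λ ξ) := fun ξ =>
    ⟨specification_univ V α hV0 Λ ξ⟩
  -- Measurability in `ξ` is carried through the induction, since integrating complements and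
  -- disjoint unions relies on it.
  suffices h : Measurable (fun ξ => specification V α θ Λ ξ B) ∧
      ∫⁻ ξ, specification V α θ Λ ξ B ∂μ = μ B from h.2.symm
  induction B, hB using MeasurableSpace.induction_on_inter rfl (isPiSystem_cylinders _) with
  | empty => simp
  | basic A hA =>
    obtain ⟨C, a, hC, ha, rfl⟩ := hA
    refine ⟨?_, lintegral_specification_cyl V α hV0 hμ hC ha⟩
    simp only [specification_cyl_of_box_subset V α hC ha]
    exact Finset.measurable_sum _ fun c _ =>
      measurable_const.indicator (measurableSet_cyl C (a * c))
  | compl A hA ih =>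
    have hA' := generateFrom_cylinders_le _ A hA
    simp only [prob_compl_eq_one_sub hA']
    refine ⟨ih.1.const_sub 1, ?_⟩
    rw [lintegral_sub ih.1 (by rw [ih.2]; exact measure_ne_top _ _)
      (Filter.Eventually.of_forall fun ξ => prob_le_one), ih.2]
    simp
  | iUnion f hd hf ih =>
    have hf' := fun i => generateFrom_cylinders_le _ (f i) (hf i)
    simp only [measure_iUnion hd hf']
    refine ⟨Measurable.tsum fun i => (ih i).1, ?_⟩
    rw [lintegral_tsum fun i => (ih i).1.aemeasurable]
    exact tsum_congr fun i => (ih i).2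

theorem existsUnique_gibbs (hV : ∀ x, 0 ≤ V x) (hV0 : V 0 = 0) (hα : 0 ≤ α)
    (hpath : ∀ s, pathTotal (kern V α θ) s < ∞)
    (hpath' : ∀ s, pathTotal (fun u v => kern V α θ v u) s < ∞) :
    ∃! μ : Measure (Equiv.Perm (Points θ)), IsGibbs V α θ μ ∧ ∀ᵐ σ ∂μ, IsFiniteCycle σ := by
  choose κ hκ using exists_tendsto_avoidProb (kern_self (θ := θ) V α hV0)
    fun s => tsum_influence_lt_top s (hpath s) (hpath' s)
  obtain ⟨μ, hμp, hfc, hμ⟩ := exists_measure_cyl V α hV hV0 hα hpath hκ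
  refine ⟨μ, ⟨isGibbs_of_measure_cyl V α hV0 hfc hμ, hfc⟩, ?_⟩
  rintro ν ⟨hν, hνfc⟩
  have := hν.1
  refine ext_of_cyl hνfc hfc fun C a ha => ?_
  rw [hν.measure_cyl V α hV hV0 hα hνfc (hκ C) ha, hμ C a ha]

end Gibbs

/-! ### From the smallness condition to `ρ φ < 1`, and the conclusion. -/

theorem r0_le_one : r0 ≤ 1 := (Classical.choose_spec existsUnique_r0.exists).1.2

/-- Indeed `exp (1/2 - ρ) ≥ 3/2 - ρ ≥ 1 - 2ρ`. -/
theorem le_densityConst {ρ : ℝ} (h0 : 0 ≤ ρ) (h : ρ < 1 / 2) : ρ ≤ densityConst ρ := by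
  rw [densityConst, le_div_iff₀ (by linarith)]
  refine mul_le_mul_of_nonneg_left ?_ h0
  have := Real.add_one_le_exp (-ρ + 1 / 2)
  linarith

theorem mul_phi_lt_one {d : ℕ} {V : EuclideanSpace ℝ (Fin d) → ℝ} {α : ℝ} {ρ : ℝ≥0}
    (hρ : (ρ : ℝ) < 1 / 2)
    (h : ENNReal.ofReal (densityConst ρ) * phi V α < ENNReal.ofReal r0) : ρ * phi V α < 1 := by
  calc ρ * phi V α ≤ ENNReal.ofReal (densityConst ρ) * phi V α := by
        gcongr
        rw [← ENNReal.ofReal_coe_nnreal]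
        exact ENNReal.ofReal_le_ofReal (le_densityConst ρ.2 hρ)
    _ < ENNReal.ofReal r0 := h
    _ ≤ 1 := ENNReal.ofReal_le_one.2 r0_le_one

theorem toReal_sub {d : ℕ} (x y : Site d) : toReal (x - y) = toReal x - toReal y := by
  ext i; simp [toReal]

theorem tsum_siteKernel {d : ℕ} (V : EuclideanSpace ℝ (Fin d) → ℝ) (α : ℝ) (x : Site d) :
    ∑' y, (siteKernel V α x y : ℝ≥0∞) = phi V α := by
  rw [phi, ← (Equiv.subRight x).tsum_eq
    fun z => ENNReal.ofReal (Real.exp (-α * V (toReal z)))]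
  simp only [Equiv.subRight_apply, toReal_sub]
  rfl

theorem tsum_siteKernel' {d : ℕ} (V : EuclideanSpace ℝ (Fin d) → ℝ) (α : ℝ) (x : Site d) :
    ∑' y, (siteKernel V α y x : ℝ≥0∞) = phi V α := by
  rw [phi, ← (Equiv.subLeft x).tsum_eq
    fun z => ENNReal.ofReal (Real.exp (-α * V (toReal z)))]
  simp only [Equiv.subLeft_apply, toReal_sub]
  rfl

end SpatialPerm

theorem theorem2 (d : ℕ) (V : EuclideanSpace ℝ (Fin d) → ℝ)
    (hV : ∀ x, 0 ≤ V x) (hV0 : V 0 = 0)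
    (hφ : ∃ α₀ : ℝ, 0 ≤ α₀ ∧ ∀ β : ℝ, α₀ < β → SpatialPerm.phi V β < ∞)
    (ρ : ℝ≥0) (hρ0 : 0 < ρ) (hρ : (ρ : ℝ) < 1 / 2)
    (hgood : SpatialPerm.IsGoodDensity V ρ)
    (α : ℝ) (hα : 0 < α)
    (hsmall : ENNReal.ofReal (SpatialPerm.densityConst ρ) * SpatialPerm.phi V α <
      ENNReal.ofReal SpatialPerm.r0) :
    ∀ᵐ θ ∂(SpatialPerm.envLaw d ρ),
      ∃! μ : Measure (Equiv.Perm (SpatialPerm.Points θ)),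
        SpatialPerm.IsGibbs V α θ μ ∧ ∀ᵐ σ ∂μ, SpatialPerm.IsFiniteCycle σ := by
  have h := SpatialPerm.mul_phi_lt_one hρ hsmall
  filter_upwards [SpatialPerm.ae_pathTotal_lt_top (SpatialPerm.siteKernel V α)
      (fun x => (SpatialPerm.tsum_siteKernel V α x).le) h,
    -- Paths into `s` are paths from `s` for the reversed kernel. Its sums are again `phi V α`, by
    -- reflection of the lattice, without any symmetry of `V`.
    SpatialPerm.ae_pathTotal_lt_top (fun x y => SpatialPerm.siteKernel V α y x)
      (fun x => (SpatialPerm.tsum_siteKernel' V α x).le) h] with θ h1 h2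
  exact SpatialPerm.existsUnique_gibbs V α hV hV0 hα.le h1 h2
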